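/- Let $\mathbb K=\mathbb R$ or $\mathbb K=\mathbb C$, let $\kappa\in\mathbb K$, and let $m,n\ge 0$ be integers. For $x,t\in\mathbb K$ define $\varphi_k(x,t;\kappa)$, $k\ge 0$, as the coefficients in $$\sum_{k=0}^\infty \frac{\varphi_k(x,t;\kappa)\,\lambda^k}{k!}=\exp\{(x+2\kappa t)\lambda-t\lambda^2\}\qquad(\lambda\in\mathbb K),$$ and let $$\Phi_{m,n}(x,t;\kappa)=\mathcal W_x(\varphi_m,\varphi_{m+1},\ldots,\varphi_{m+n-1})=\det\bigl(\partial_x^{\,i}\varphi_{m+j}\bigr)_{0\le i,j\le n-1}$$ be the Wronskian with respect to $x$ (so $\Phi_{m,0}=1$). Then the series converges for all $\lambda$; one has $$\varphi_k(x,t;\kappa)=t^{k/2}H_k\!\left(\frac{x+2\kappa t}{\sqrt{4t}}\right),\qquad H_k(z)=(-1)^k e^{z^2}\frac{d^k}{dz^k}e^{-z^2},$$ for $t>0$ if $\mathbb K=\mathbb R$, and for $t\neq 0$ if $\mathbb K=\mathbb C$, with $t^{k/2}=s^k$ and $\sqrt{4t}=2s$ for either square root $s$ of $t$; for each fixed $t$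 and $\kappa$ the function $x\mapsto\Phi_{m,n}(x,t;\kappa)$ has only finitely many zeros; and the functions $$U^{[1]}_{m,n}(x,t;\kappa)=\ln\left\{\frac{\Phi_{m+1,n}(x,t;\kappa)}{\Phi_{m,n}(x,t;\kappa)}\right\}+\frac{x^2}{4t}-\left(m+n+\tfrac12\right)\ln t,$$ $$U^{[2]}_{m,n}(x,t;\kappa)=\ln\left\{\frac{\Phi_{m,n}(x,t;\kappa)}{\Phi_{m,n+1}(x,t;\kappa)}\right\}+\frac{x^2}{4t}+\left(m+n+\tfrac12\right)\ln t,$$ $$U^{[3]}_{m,n}(x,t;\kappa)=\ln\left\{\frac{\Phi_{m,n+1}(x,t;\kappa)}{\Phi_{m+1,n}(x,t;\kappa)}\right\}-\kappa(x+\kappa t)$$ are smooth (holomorphic if $\mathbb K=\mathbb C$) solutions of the dispersive water wave equation $$U_{tt}+2U_tU_{xx}+4U_xU_{xt}+6U_x^2U_{xx}-U_{xxxx}=0$$ wherever the two $\Phi$'s occurring in them do not vanish and, for $U^{[1]}$ and $U^{[2]}$, $t\ne0$. Precisely: for $\mathbb K=\mathbb R$ this holds on the open set of all such $(x,t)\in\mathbb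 R^2$, with $\ln r$ read as $\ln|r|$; for $\mathbb K=\mathbb C$ it holds on every open $\Omega\subseteq\mathbb C^2$ of such points on which continuous branches of the logarithms occurring in the formula are given, for every choice of these branches. -/

import Mathlib

open scoped ContDiff

namespace DWW

noncomputable section

/-- The Hermite polynomial `H_n` in the physicists' normalization, as a function on `𝕜 = ℝ` or
`𝕜 = ℂ`: `H_n(z) = (-1)^n exp(z²) (d/dz)^n exp(-z²)`. -/
def hermiteH {𝕜 : Type*} [RCLike 𝕜] (n : ℕ) (z : 𝕜) : 𝕜 :=
  (-1) ^ n * NormedSpace.exp (z ^ 2) * iteratedDeriv n (fun y : 𝕜 => NormedSpace.exp (-y ^ 2)) z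

/-- The function `φ_n(x,t;κ)` with exponential generating function
`∑ φ_n(x,t;κ) λ^n / n! = exp((x + 2κt)λ - tλ²)`, i.e. the `n`-th derivative
of the right-hand side with respect to `λ` at `λ = 0`. -/
def phi {𝕜 : Type*} [RCLike 𝕜] (n : ℕ) (x t κ : 𝕜) : 𝕜 :=
  iteratedDeriv n (fun l : 𝕜 => NormedSpace.exp ((x + 2 * κ * t) * l - t * l ^ 2)) 0

/-- The Wronskian `W(f_0, …, f_{n-1})` of `n` functions of one variable
(the empty Wronskian, `n = 0`, is `1`). -/
def wronskian {𝕜 : Type*} [RCLike 𝕜] {n : ℕ} (f : Fin n → 𝕜 → 𝕜) (x : 𝕜) : 𝕜 :=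
  (Matrix.of fun i j : Fin n => iteratedDeriv (i : ℕ) (f j) x).det

/-- `Φ_{m,n}(x,t;κ) = W_x(φ_m, φ_{m+1}, …, φ_{m+n-1})`. -/
def Phi {𝕜 : Type*} [RCLike 𝕜] (m n : ℕ) (x t κ : 𝕜) : 𝕜 :=
  wronskian (fun (j : Fin n) (y : 𝕜) => phi (m + (j : ℕ)) y t κ) x

/-- `U(x,t)` is a (smooth) solution on the open set `Ω` of `(x,t)`-space of the dispersive water
wave equation `U_tt + 2 U_t U_xx + 4 U_x U_xt + 6 U_x² U_xx - U_xxxx = 0`. For `𝕜 = ℂ`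
the derivatives are complex derivatives and `U` is holomorphic. -/
def IsDWWSolutionOn {𝕜 : Type*} [RCLike 𝕜] (Ω : Set (𝕜 × 𝕜)) (U : 𝕜 → 𝕜 → 𝕜) : Prop :=
  IsOpen Ω ∧ ContDiffOn 𝕜 ∞ (fun p : 𝕜 × 𝕜 => U p.1 p.2) Ω ∧
  ∀ x t : 𝕜, (x, t) ∈ Ω →
    iteratedDeriv 2 (fun s => U x s) t
      + 2 * deriv (fun s => U x s) t * iteratedDeriv 2 (fun y => U y t) x
      + 4 * deriv (fun y => U y t) x * deriv (fun s => deriv (fun y => U y s) x) t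
      + 6 * (deriv (fun y => U y t) x) ^ 2 * iteratedDeriv 2 (fun y => U y t) x
      - iteratedDeriv 4 (fun y => U y t) x = 0

/-- `L(x,t)` is a continuous branch on `Ω ⊆ ℂ²` of the logarithm of `f(x,t)`; in particular `f` has
no zeros on `Ω`. -/
def IsLogBranchOn (Ω : Set (ℂ × ℂ)) (f L : ℂ → ℂ → ℂ) : Prop :=
  ContinuousOn (fun p : ℂ × ℂ => L p.1 p.2) Ω ∧
  ∀ x t : ℂ, (x, t) ∈ Ω → Complex.exp (L x t) = f x t

end

end DWW

/-! Put z = x + 2κt. Each Φ_{m,n} is a polynomial `tau` in z and t, homogeneous of degree mn when z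
has weight 1 and t has weight 2. On each triangle of indices (m,n), (m+1,n), (m,n+1) the three tau
functions satisfy pairwise Hirota bilinear equations. These follow by induction on n
(`TauLevel.succ`): the base case is the Hermite recursion with its ODE, and the Jacobi determinant
identity for Wronskians (`wr_mul_derivation_wr`) introduces the next tau function.

Divided by the products of tau functions and subtracted from each other, the three equations become
the symmetric fourth Painlevé system g_i' = g_i(g_{i+1} - g_{i+2}) + a_i/(2t) with sum z/(2t), where
the g_i are logarithmic derivatives of ratios, one of them shifted by z/(2t). Homogeneity supplies
the t-derivatives. Since x²/(4t) = z²/(4t) - κ(x + κt), the i-th potential has U_x = z/(2t) - g_i -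
κ. The system is cyclically symmetric, so the single computation `dwwExpr_eq_zero_of_symmetric`
serves all three.

That computation needs t and all three tau functions to be nonzero, whereas each potential involves
only two of them. For fixed t a tau function has finitely many zeros, so generic points are dense,
and continuity of the equation's left-hand side covers the rest. -/

namespace DWW

/-! ### Jacobi's determinant identity and Wronskians over a derivation -/

section Wronskian

open Matrix Finset

/-- Schur complement form of the Desnanot–Jacobi identity. -/
theorem det_fromBlocks_bordered {K ι : Type*} [Field K] [Fintype ι] [DecidableEq ι]
    (A : Matrix ι ι K) (hA : A.det ≠ 0)
    (b₁ b₂ c₁ c₂ : ι → K) (d : Matrix (Fin 2) (Fin 2) K) :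
    (fromBlocks (fromBlocks A (of fun i (_ : Fin 1) => b₁ i) (of fun (_ : Fin 1) j => c₁ j)
          (of fun (_ _ : Fin 1) => d 0 0))
        (of fun i (_ : Fin 1) => Sum.elim b₂ (fun _ => d 0 1) i)
        (of fun (_ : Fin 1) j => Sum.elim c₂ (fun _ => d 1 0) j)
        (of fun (_ _ : Fin 1) => d 1 1)).det * A.det
      = (fromBlocks A (of fun i (_ : Fin 1) => b₁ i) (of fun (_ : Fin 1) j => c₁ j)
          (of fun (_ _ : Fin 1) => d 0 0)).det
        * (fromBlocks A (of fun i (_ : Fin 1) => b₂ i) (of fun (_ : Fin 1) j => c₂ j)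
          (of fun (_ _ : Fin 1) => d 1 1)).det
      - (fromBlocks A (of fun i (_ : Fin 1) => b₂ i) (of fun (_ : Fin 1) j => c₁ j)
          (of fun (_ _ : Fin 1) => d 0 1)).det
        * (fromBlocks A (of fun i (_ : Fin 1) => b₁ i) (of fun (_ : Fin 1) j => c₂ j)
          (of fun (_ _ : Fin 1) => d 1 0)).det := by
  have : Invertible A := A.invertibleOfIsUnitDet (isUnit_iff_ne_zero.mpr hA)
  have key : (fromBlocks (fromBlocks A (of fun i (_ : Fin 1) => b₁ i)
          (of fun (_ : Fin 1) j => c₁ j) (of fun (_ _ : Fin 1) => d 0 0))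
        (of fun i (_ : Fin 1) => Sum.elim b₂ (fun _ => d 0 1) i)
        (of fun (_ : Fin 1) j => Sum.elim c₂ (fun _ => d 1 0) j)
        (of fun (_ _ : Fin 1) => d 1 1)).det
      = (fromBlocks A (of fun i k => ![b₁ i, b₂ i] k) (of fun k j => ![c₁ j, c₂ j] k) d).det := by
    rw [← det_submatrix_equiv_self
      ((Equiv.sumAssoc ι (Fin 1) (Fin 1)).trans
        (Equiv.sumCongr (Equiv.refl ι) (finSumFinEquiv : Fin 1 ⊕ Fin 1 ≃ Fin 2)))
      (fromBlocks A (of fun i k => ![b₁ i, b₂ i] k) (of fun k j => ![c₁ j, c₂ j] k) d)]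
    congr 1
    ext i j
    rcases i with (i | i) | i <;> rcases j with (j | j) | j <;>
      first
        | (fin_cases i <;> fin_cases j <;> rfl)
        | (fin_cases i <;> rfl)
        | (fin_cases j <;> rfl)
        | rfl
  rw [key]
  -- Every bordered determinant is det A times a Schur complement, so the claim is the formula for
  -- the 2 × 2 determinant of complements.
  simp only [det_fromBlocks₁₁, det_fin_two, det_unique, Matrix.sub_apply, Matrix.mul_apply, of_apply,
    Matrix.cons_val_zero, Matrix.cons_val_one]
  ring

/-- The interior minor omits the first and last columns and the last two rows. Rotating column 0
behind columns 1, …, n produces the bordered block form; each of the three products then acquires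
exactly one factor ε, the sign of the rotation, which cancels. -/
theorem desnanot_jacobi_of_ne_zero {K : Type*} [Field K] {n : ℕ}
    (M : Matrix (Fin (n + 2)) (Fin (n + 2)) K)
    (h : (M.submatrix (fun i : Fin n => i.castSucc.castSucc) fun j => j.succ.castSucc).det ≠ 0) :
    M.det * (M.submatrix (fun i : Fin n => i.castSucc.castSucc) fun j => j.succ.castSucc).det
      = (M.submatrix Fin.castSucc Fin.castSucc).det
          * (M.submatrix (Fin.last n).castSucc.succAbove Fin.succ).det
        - (M.submatrix Fin.castSucc Fin.succ).det
          * (M.submatrix (Fin.last n).castSucc.succAbove Fin.castSucc).det := by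
  set e : Fin n ⊕ Fin 1 ≃ Fin (n + 1) := finSumFinEquiv with he
  set g : Fin (n + 1) ⊕ Fin 1 ≃ Fin (n + 2) := finSumFinEquiv with hg
  have hel : ∀ i, e (Sum.inl i) = i.castSucc := fun i => rfl
  have her : ∀ i, e (Sum.inr i) = Fin.last n := fun i => by fin_cases i; rfl
  have hgl : ∀ i, g (Sum.inl i) = i.castSucc := fun i => rfl
  have hgr : ∀ i, g (Sum.inr i) = Fin.last (n + 1) := fun i => by fin_cases i; rfl
  set ρ := finRotate (n + 1) with hρ
  have hρl : ∀ i : Fin n, ρ i.castSucc = i.succ := fun i => by simp [hρ]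
  have hρr : ρ (Fin.last n) = 0 := by simp [hρ]
  set ε : K := ((Equiv.Perm.sign ρ : ℤ) : K) with hε
  have hε0 : ε ≠ 0 := by
    rcases Int.units_eq_one_or (Equiv.Perm.sign ρ) with h | h <;> simp [hε, h]
  have small : ∀ N : Matrix (Fin (n + 1)) (Fin (n + 1)) K,
      (N.submatrix e (ρ ∘ e)).det = ε * N.det := by
    intro N
    rw [← det_permute' ρ N, ← det_submatrix_equiv_self e (N.submatrix id ρ)]
    rfl
  have big : (M.submatrix (g ∘ Sum.map e id) (g ∘ Sum.map (ρ ∘ e) id)).det = ε * M.det := by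
    have h1 := det_permute' (Equiv.Perm.sumCongr ρ (1 : Equiv.Perm (Fin 1))) (M.submatrix g g)
    rw [Equiv.Perm.sign_sumCongr, Equiv.Perm.sign_one, mul_one, det_submatrix_equiv_self] at h1
    rw [hε, ← h1, ← det_submatrix_equiv_self (Equiv.sumCongr e (Equiv.refl (Fin 1)))]
    congr 1
    ext i j
    rcases i with i | i <;> rcases j with j | j <;> rfl
  have r1 : ∀ i : Fin n, (Fin.last n).castSucc.succAbove i.castSucc = i.castSucc.castSucc := by
    intro i
    rw [Fin.succAbove_of_castSucc_lt]
    simp [Fin.lt_def]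
  have r2 : (Fin.last n).castSucc.succAbove (Fin.last n) = Fin.last (n + 1) := by
    rw [Fin.succAbove_of_le_castSucc] <;> simp
  have H := det_fromBlocks_bordered
    (M.submatrix (fun i : Fin n => i.castSucc.castSucc) fun j => j.succ.castSucc) h
    (fun i => M i.castSucc.castSucc 0) (fun i => M i.castSucc.castSucc (Fin.last _))
    (fun j => M (Fin.last n).castSucc j.succ.castSucc) (fun j => M (Fin.last _) j.succ.castSucc)
    !![M (Fin.last n).castSucc 0, M (Fin.last n).castSucc (Fin.last _);
      M (Fin.last _) 0, M (Fin.last _) (Fin.last _)]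
  have d0 := big
  have d1 := small (M.submatrix Fin.castSucc Fin.castSucc)
  have d2 := small (M.submatrix (Fin.last n).castSucc.succAbove Fin.castSucc)
  have d3 := det_submatrix_equiv_self e (M.submatrix (Fin.last n).castSucc.succAbove Fin.succ)
  have d4 := det_submatrix_equiv_self e (M.submatrix Fin.castSucc Fin.succ)
  rw [← mul_right_inj' hε0, mul_sub, ← mul_assoc, ← mul_assoc, ← mul_assoc, ← d0, ← d1,
    mul_right_comm, ← d2, ← d3, ← d4]
  rw [mul_comm (Matrix.det _) (det (submatrix (submatrix M Fin.castSucc Fin.succ) _ _))]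
  convert H using 2
  · congr 1
    ext i j
    rcases i with (i | i) | i <;> rcases j with (j | j) | j <;>
      simp [hel, her, hgl, hgr, hρl, hρr]
  · congr 1
    · congr 1
      ext i j
      rcases i with i | i <;> rcases j with j | j <;> simp [hel, her, hρl, hρr]
    · congr 1
      ext i j
      rcases i with i | i <;> rcases j with j | j <;> simp [hel, her, r1, r2, ← Fin.castSucc_succ]
  · congr 1
    · congr 1
      ext i j
      rcases i with i | i <;> rcases j with j | j <;> simp [hel, her, ← Fin.castSucc_succ]
    · congr 1
      ext i j
      rcases i with i | i <;> rcases j with j | j <;> simp [hel, her, hρl, hρr, r1, r2]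

variable {S R : Type*} [CommRing S] [CommRing R] [Algebra S R] (D : Derivation S R R)

theorem derivation_prod {ι : Type*} [DecidableEq ι] (s : Finset ι) (f : ι → R) :
    D (∏ i ∈ s, f i) = ∑ i ∈ s, (∏ j ∈ s.erase i, f j) * D (f i) := by
  induction s using Finset.induction_on with
  | empty => simp
  | insert a s ha ih =>
    rw [prod_insert ha, D.leibniz, ih, sum_insert ha, erase_insert ha, smul_eq_mul, smul_eq_mul,
      add_comm, mul_sum]
    congr 1
    refine sum_congr rfl fun i hi => ?_
    have : a ≠ i := fun h => ha (h ▸ hi)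
    rw [erase_insert_of_ne this, prod_insert (fun h => ha (mem_of_mem_erase h)), mul_assoc]

theorem derivation_det {ι : Type*} [Fintype ι] [DecidableEq ι] (M : Matrix ι ι R) :
    D M.det = ∑ k, (M.updateRow k fun j => D (M k j)).det := by
  -- The Leibniz formula takes its product over columns, so the column version is direct and the row
  -- version is its transpose.
  have h : ∀ N : Matrix ι ι R, D N.det = ∑ k, (N.updateCol k fun i => D (N i k)).det := by
    intro N
    simp only [det_apply, map_sum, Units.smul_def, map_zsmul, derivation_prod]
    rw [sum_comm]
    refine sum_congr rfl fun σ _ => ?_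
    rw [smul_sum]
    refine sum_congr rfl fun k _ => ?_
    congr 1
    rw [← mul_prod_erase univ _ (mem_univ k), mul_comm]
    congr 1
    · simp
    · refine prod_congr rfl fun i hi => ?_
      rw [updateCol_ne (ne_of_mem_erase hi)]
  rw [← det_transpose, h]
  refine sum_congr rfl fun k _ => ?_
  rw [← det_transpose, updateCol_transpose, transpose_transpose]
  rfl

/-- The Wronskian of `f 0, …, f (n - 1)` with respect to a derivation. -/
def wr (f : ℕ → R) (n : ℕ) : R :=
  (Matrix.of fun i j : Fin n => D^[(i : ℕ)] (f j)).det

/-- Differentiating any row but the last duplicates the row below it. Only the last term survives: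
its rows are those of order 0, …, n + 1 with n skipped. -/
theorem derivation_wr (f : ℕ → R) (n : ℕ) :
    D (wr D f (n + 1))
      = (Matrix.of fun i j : Fin (n + 1) =>
          D^[((Fin.last n).castSucc.succAbove i : Fin (n + 2))] (f j)).det := by
  rw [wr, derivation_det, Fin.sum_univ_castSucc, sum_eq_zero, zero_add]
  · congr 1
    ext i j
    induction i using Fin.lastCases with
    | last =>
      rw [updateRow_self, of_apply, of_apply, Fin.succAbove_of_le_castSucc _ _ le_rfl,
        ← Function.iterate_succ_apply' (D : R → R)]
      rfl
    | cast i =>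
      rw [updateRow_ne (Fin.castSucc_lt_last i).ne, of_apply, of_apply,
        Fin.succAbove_of_castSucc_lt _ _ (by simp [Fin.lt_def])]
      rfl
  · intro k _
    refine det_zero_of_row_eq (i := k.castSucc) (j := k.succ) Fin.castSucc_lt_succ.ne ?_
    ext j
    rw [updateRow_self, updateRow_ne Fin.castSucc_lt_succ.ne', of_apply, of_apply,
      ← Function.iterate_succ_apply' (D : R → R)]
    rfl

/-- By `derivation_wr`, the minors in Jacobi's identity for the (n + 2)-fold Wronskian are
Wronskians and their derivatives. The fraction field supplies the field over which that identity is
available. -/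
theorem wr_mul_derivation_wr [IsDomain R] (f : ℕ → R) (n : ℕ)
    (h : wr D (fun j => f (j + 1)) n ≠ 0) :
    wr D f (n + 1) * D (wr D (fun j => f (j + 1)) (n + 1))
        - D (wr D f (n + 1)) * wr D (fun j => f (j + 1)) (n + 1)
      = wr D f (n + 2) * wr D (fun j => f (j + 1)) n := by
  have hinj := IsFractionRing.injective R (FractionRing R)
  set φ := algebraMap R (FractionRing R)
  have H := desnanot_jacobi_of_ne_zero
    (φ.mapMatrix (Matrix.of fun i j : Fin (n + 2) => D^[(i : ℕ)] (f j))) (by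
      have := (map_ne_zero_iff φ hinj).mpr h
      rw [wr, RingHom.map_det] at this
      exact this)
  apply hinj
  rw [derivation_wr, derivation_wr, map_sub, map_mul, map_mul, map_mul, wr, wr, wr, wr]
  simp only [RingHom.map_det]
  rw [mul_comm (det (φ.mapMatrix _)) (det (φ.mapMatrix (of fun (i j : Fin (n + 1)) =>
    D^[(i : ℕ)] (f (j + 1))))) ]
  exact H.symm

end Wronskian

/-! ### Bilinear relations on the triangular lattice of tau functions -/

section Bilinear

variable {S R : Type*} [CommRing S] [CommRing R] [Algebra S R] (D : Derivation S R R)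

theorem derivation_two : D (2 : R) = 0 := by exact_mod_cast D.map_natCast 2

/-- The bilinear equation `2t D_x² F·G + x D_x F·G + c F G = 0`. -/
def BilinearEq (x t c F G : R) : Prop :=
  2 * t * (D (D F) * G - 2 * (D F * D G) + F * D (D G)) + x * (D F * G - F * D G) + c * (F * G) = 0

variable {D} {x t : R} {φ : ℕ → R}

/-- A sequence of Appell type: `φ₀ = 1`, `φ_{k+1} = x φ_k - 2t φ_k'`. -/
structure IsHermiteSeq (D : Derivation S R R) (x t : R) (φ : ℕ → R) : Prop where
  zero : φ 0 = 1
  succ (k : ℕ) : φ (k + 1) = x * φ k - 2 * t * D (φ k)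

theorem IsHermiteSeq.derivation_succ (hx : D x = 1) (ht : D t = 0) (h : IsHermiteSeq D x t φ)
    (k : ℕ) : D (φ (k + 1)) = (k + 1) * φ k := by
  induction k with
  | zero => simp [h.succ 0, h.zero, hx]
  | succ k ih =>
    have h1 := congrArg D (h.succ (k + 1))
    have h2 := congrArg D ih
    have h3 : D ((k : R) + 1) = 0 := by exact_mod_cast D.map_natCast (k + 1)
    simp only [map_sub, D.leibniz, smul_eq_mul, hx, ht, derivation_two, h3] at h1 h2
    push_cast
    linear_combination h1 + x * ih - 2 * t * h2 - (k + 1) * h.succ k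

theorem IsHermiteSeq.ode (hx : D x = 1) (ht : D t = 0) (h : IsHermiteSeq D x t φ) (k : ℕ) :
    2 * t * D (D (φ k)) - x * D (φ k) + k * φ k = 0 := by
  have h1 := h.derivation_succ hx ht k
  have h2 := congrArg D (h.succ k)
  simp only [map_sub, D.leibniz, smul_eq_mul, hx, ht, derivation_two] at h2
  linear_combination h2 - h1

variable [IsDomain R]

/-- In this and the next five lemmas, bilinear equations on two edges of a triangle and a
first-order relation defining the reflection of a vertex yield new relations for the reflected
vertex. The method is always to differentiate the first-order relation, eliminate second derivatives
by the bilinear equations, and cancel a nonzero factor. Here A, B, C sit at (m,n), (m+1,n), (m,n+1)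
and E at (m+1,n+1) is A reflected in BC. -/
theorem BilinearEq.opposite_left (hx : D x = 1) (ht : D t = 0) {A B C E a b : R} (hA : A ≠ 0)
    (h₁ : BilinearEq D x t a B A) (h₂ : BilinearEq D x t b A C)
    (h₃ : A * E = x * (B * C) - 2 * t * (D C * B - C * D B)) :
    D E * A - E * D A = (b - a + 1) * (B * C) := by
  have h₃' := congrArg D h₃
  simp only [map_sub, D.leibniz, smul_eq_mul, hx, ht, derivation_two] at h₃'
  unfold BilinearEq at h₁ h₂
  apply mul_left_cancel₀ hA
  linear_combination A * h₃' - 2 * D A * h₃ + C * h₁ - B * h₂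

/-- Here P at (m,n+2) is B reflected in the edge CE, and the relation defining it is Jacobi's
identity. -/
theorem BilinearEq.opposite_middle {B C E P b c : R} (hB : B ≠ 0)
    (h₂ : BilinearEq D x t b B E) (h₃ : BilinearEq D x t c B C)
    (h₁ : C * D E - D C * E = P * B) :
    x * (P * B) - 2 * t * (D P * B - P * D B) = (b - c) * (C * E) := by
  have h₁' := congrArg D h₁
  simp only [map_sub, D.leibniz, smul_eq_mul] at h₁'
  unfold BilinearEq at h₂ h₃
  apply mul_left_cancel₀ hB
  linear_combination -(x * B + 4 * t * D B) * h₁ + 2 * t * B * h₁' - C * h₂ + E * h₃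

theorem BilinearEq.opposite_right {A B C Z a c k : R} (hB : B ≠ 0)
    (hk : k ≠ 0) (hDk : D k = 0) (hck : c - a = k)
    (h₁ : BilinearEq D x t a B A) (h₃ : BilinearEq D x t c B C)
    (h₂ : D C * A - C * D A = k * (B * Z)) :
    x * (Z * B) - 2 * t * (D Z * B - Z * D B) = C * A := by
  have h₂' := congrArg D h₂
  simp only [map_sub, D.leibniz, smul_eq_mul, hDk] at h₂'
  unfold BilinearEq at h₁ h₃
  apply mul_left_cancel₀ (mul_ne_zero hk hB)
  linear_combination C * h₁ - A * h₃ - (4 * t * D B + x * B) * h₂ + 2 * t * B * h₂'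
    + A * B * C * hck

/-- This lemma and the next two give the edges EC, CP and EP, that is, the triangle at level n + 1.
-/
theorem BilinearEq.reflect_left {A B C E b k : R} (hA : A ≠ 0)
    (hDk : D k = 0) (h₂ : BilinearEq D x t b A C)
    (h₃ : A * E = x * (B * C) - 2 * t * (D C * B - C * D B))
    (hk : D E * A - E * D A = k * (B * C)) :
    BilinearEq D x t (b - k) E C := by
  have hk' := congrArg D hk
  simp only [map_sub, D.leibniz, smul_eq_mul, hDk] at hk'
  unfold BilinearEq at h₂ ⊢
  apply mul_left_cancel₀ hA
  linear_combination 2 * t * C * hk' + (x * C - 4 * t * D C) * hk + E * h₂ - k * C * h₃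

theorem BilinearEq.reflect_middle_left (hx : D x = 1) (ht : D t = 0) {B C E P c k : R}
    (hB : B ≠ 0) (hDk : D k = 0) (h₃ : BilinearEq D x t c B C)
    (h₁ : C * D E - D C * E = P * B)
    (hk : x * (P * B) - 2 * t * (D P * B - P * D B) = k * (C * E)) :
    BilinearEq D x t (c + k - 1) C P := by
  have hk' := congrArg D hk
  simp only [map_sub, D.leibniz, smul_eq_mul, hx, ht, hDk, derivation_two] at hk'
  unfold BilinearEq at h₃ ⊢
  apply mul_left_cancel₀ hB
  linear_combination P * h₃ - k * C * h₁ - C * hk' + 2 * D C * hk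

theorem BilinearEq.reflect_middle_right (hx : D x = 1) (ht : D t = 0) {B C E P b k : R}
    (hB : B ≠ 0) (hDk : D k = 0) (h₂ : BilinearEq D x t b B E)
    (h₁ : C * D E - D C * E = P * B)
    (hk : x * (P * B) - 2 * t * (D P * B - P * D B) = k * (C * E)) :
    BilinearEq D x t (b - k - 1) E P := by
  have hk' := congrArg D hk
  simp only [map_sub, D.leibniz, smul_eq_mul, hx, ht, hDk, derivation_two] at hk'
  unfold BilinearEq at h₂ ⊢
  apply mul_left_cancel₀ hB
  linear_combination P * h₂ + k * E * h₁ - E * hk' + 2 * D E * hk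

/-- Bilinear relations among tau functions `τ m n`, `m = 0, 1, …`, for a fixed `n`: three of
second order on every triangle `(m,n), (m+1,n), (m,n+1)`, and two of first order. -/
structure TauLevel (D : Derivation S R R) (x t : R) (τ : ℕ → ℕ → R) (n : ℕ) : Prop where
  left (m : ℕ) : BilinearEq D x t (-n) (τ (m + 1) n) (τ m n)
  right (m : ℕ) : BilinearEq D x t m (τ m n) (τ m (n + 1))
  middle (m : ℕ) : BilinearEq D x t (m - n) (τ (m + 1) n) (τ m (n + 1))
  up (m : ℕ) : τ m n * τ (m + 1) (n + 1) = x * (τ (m + 1) n * τ m (n + 1))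
    - 2 * t * (D (τ m (n + 1)) * τ (m + 1) n - τ m (n + 1) * D (τ (m + 1) n))
  down (m : ℕ) : D (τ (m + 1) (n + 1)) * τ (m + 1) n - τ (m + 1) (n + 1) * D (τ (m + 1) n)
    = (m + 1) * (τ (m + 2) n * τ m (n + 1))

variable [CharZero R] {τ : ℕ → ℕ → R} {n : ℕ}

theorem TauLevel.succ (hx : D x = 1) (ht : D t = 0) (ht0 : t ≠ 0) (hτ : ∀ m n, τ m n ≠ 0)
    (hJ : ∀ m n, τ m (n + 1) * D (τ (m + 1) (n + 1)) - D (τ m (n + 1)) * τ (m + 1) (n + 1)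
      = τ m (n + 2) * τ (m + 1) n)
    (H : TauLevel D x t τ n) : TauLevel D x t τ (n + 1) := by
  have K₃ : ∀ m : ℕ, D (τ (m + 1) (n + 1)) * τ m n - τ (m + 1) (n + 1) * D (τ m n)
      = ((m + n + 1 : ℕ) : R) * (τ (m + 1) n * τ m (n + 1)) := by
    intro m
    rw [BilinearEq.opposite_left hx ht (hτ m n) (H.left m) (H.right m) (H.up m)]
    push_cast
    ring
  have K₁ : ∀ m : ℕ, x * (τ m (n + 2) * τ (m + 1) n)
      - 2 * t * (D (τ m (n + 2)) * τ (m + 1) n - τ m (n + 2) * D (τ (m + 1) n))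
      = ((n + 1 : ℕ) : R) * (τ m (n + 1) * τ (m + 1) (n + 1)) := by
    intro m
    rw [BilinearEq.opposite_middle (hτ _ _) (H.right (m + 1)) (H.middle m) (hJ m n)]
    push_cast
    ring
  have K₂ : ∀ m : ℕ, x * (τ m (n + 1) * τ (m + 2) n)
      - 2 * t * (D (τ m (n + 1)) * τ (m + 2) n - τ m (n + 1) * D (τ (m + 2) n))
      = τ (m + 1) (n + 1) * τ (m + 1) n := by
    intro m
    refine BilinearEq.opposite_right (k := ((m + 1 : ℕ) : R)) (hτ _ _)
      (Nat.cast_ne_zero.mpr m.succ_ne_zero) (D.map_natCast _) ?_ (H.left (m + 1)) (H.middle (m + 1))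
      ?_
    · ring
    · rw [H.down m]
      push_cast
      ring
  refine ⟨fun m => ?_, fun m => ?_, fun m => ?_, fun m => ?_, fun m => ?_⟩
  · convert BilinearEq.reflect_left (hτ m n) (D.map_natCast _) (H.right m) (H.up m) (K₃ m)
      using 1
    push_cast
    ring
  · convert BilinearEq.reflect_middle_left hx ht (hτ _ _) (D.map_natCast _) (H.middle m) (hJ m n)
      (K₁ m) using 1
    push_cast
    ring
  · convert BilinearEq.reflect_middle_right hx ht (hτ _ _) (D.map_natCast _) (H.right (m + 1))
      (hJ m n) (K₁ m) using 1
    push_cast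
    ring
  · have h₁ := K₁ m
    have h₂ := H.down m
    have h₃ := K₃ (m + 1)
    have h₄ := hJ (m + 1) n
    have h₅ := H.up (m + 1)
    have h₆ := K₂ m
    have h₇ := hJ m n
    push_cast at h₁ h₃
    -- Eliminating the derivatives from the first-order relations leaves derivative-free Toda-type
    -- identities. Combining two of these gives the first-order relation at the next level.
    have T₁ : τ (m + 1) (n + 1) ^ 2
        = τ (m + 2) (n + 1) * τ m (n + 1) + 2 * t * (τ m (n + 2) * τ (m + 2) n) := by
      apply mul_left_cancel₀ (hτ (m + 1) n)
      linear_combination -τ m (n + 1) * h₅ - τ (m + 1) (n + 1) * h₆ + 2 * t * τ (m + 2) n * h₇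
    have T₂ : τ (m + 1) n * τ (m + 1) (n + 2)
        = (n + 1) * τ (m + 1) (n + 1) ^ 2 + (m + 1) * (2 * t * (τ m (n + 2) * τ (m + 2) n)) := by
      apply mul_left_cancel₀ (hτ (m + 2) n)
      linear_combination -τ (m + 1) n * h₄ + τ (m + 1) (n + 1) * h₃ - τ (m + 2) (n + 1) * h₂
        + (m + 1) * τ (m + 2) n * T₁
    apply mul_left_cancel₀ (hτ (m + 1) n)
    linear_combination τ m (n + 1) * T₂ - τ (m + 1) (n + 1) * h₁ - 2 * t * τ m (n + 2) * h₂
  · have h₁ := K₁ (m + 1)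
    have h₂ := H.down m
    have h₃ := K₃ (m + 1)
    have h₄ := hJ (m + 1) n
    have h₅ := H.up (m + 1)
    have h₆ := K₂ m
    have h₇ := hJ m n
    push_cast at h₁ h₃
    have T₁ : τ (m + 1) (n + 2) * τ (m + 1) n + (m + 1) * (τ (m + 2) (n + 1) * τ m (n + 1))
        = (m + n + 2) * τ (m + 1) (n + 1) ^ 2 := by
      apply mul_left_cancel₀ (hτ (m + 2) n)
      linear_combination -τ (m + 1) n * h₄ - τ (m + 2) (n + 1) * h₂ + τ (m + 1) (n + 1) * h₃
    have T₂ : 2 * t * (τ (m + 2) n * τ m (n + 2))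
        = τ (m + 1) (n + 1) ^ 2 - τ (m + 2) (n + 1) * τ m (n + 1) := by
      apply mul_left_cancel₀ (hτ (m + 1) n)
      linear_combination -2 * t * τ (m + 2) n * h₇ + τ m (n + 1) * h₅ + τ (m + 1) (n + 1) * h₆
    apply mul_left_cancel₀ (mul_ne_zero (mul_ne_zero two_ne_zero ht0) (hτ (m + 2) n))
    linear_combination -τ (m + 1) (n + 1) * h₁ - τ (m + 1) (n + 2) * h₅
      + τ (m + 2) (n + 1) * T₁ - (m + 1) * τ (m + 2) (n + 1) * T₂

/-- At level 0 the tau functions are 1 and φ_m, and the relations reduce to the ODE, the recursion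
and the Appell property of φ. -/
theorem IsHermiteSeq.tauLevel (hx : D x = 1) (ht : D t = 0) (ht0 : t ≠ 0)
    (h : IsHermiteSeq D x t φ) (hτ : ∀ m n, wr D (fun j => φ (m + j)) n ≠ 0) (n : ℕ) :
    TauLevel D x t (fun m n => wr D (fun j => φ (m + j)) n) n := by
  induction n with
  | zero =>
    have e0 : ∀ m, wr D (fun j => φ (m + j)) 0 = 1 := fun m => by simp [wr]
    have e1 : ∀ m, wr D (fun j => φ (m + j)) 1 = φ m := fun m => by simp [wr]
    refine ⟨fun m => ?_, fun m => ?_, fun m => ?_, fun m => ?_, fun m => ?_⟩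
    · simp [BilinearEq, e0]
    · simp only [BilinearEq, e0, e1, zero_add, D.map_one_eq_zero, map_zero]
      linear_combination h.ode hx ht m
    · simp only [BilinearEq, e0, e1, zero_add, D.map_one_eq_zero, map_zero]
      push_cast
      linear_combination h.ode hx ht m
    · simp only [e0, e1, zero_add, D.map_one_eq_zero]
      linear_combination h.succ m
    · simp only [e0, e1, zero_add, D.map_one_eq_zero]
      linear_combination h.derivation_succ hx ht m
  | succ n ih =>
    refine ih.succ hx ht ht0 hτ fun m n => ?_
    have e : ∀ j, φ (m + 1 + j) = φ (m + (j + 1)) := fun j => by congr 1; omega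
    have h1 := hτ (m + 1) n
    simp only [e] at h1 ⊢
    exact wr_mul_derivation_wr D (fun j => φ (m + j)) n h1

end Bilinear

/-! ### The tau functions as weighted homogeneous polynomials -/

section Polynomials

open MvPolynomial Finset

/-- Each term of the Leibniz expansion is an eigenvector, and its eigenvalue does not depend on the
permutation. -/
theorem derivation_det_of_weights {S R ι : Type*} [CommRing S] [CommRing R] [Algebra S R]
    (D : Derivation S R R) [Fintype ι] [DecidableEq ι] (M : Matrix ι ι R) (r c : ι → R)
    (h : ∀ i j, D (M i j) = (c j - r i) * M i j) :
    D M.det = (∑ i, c i - ∑ i, r i) * M.det := by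
  rw [Matrix.det_apply, map_sum, mul_sum]
  refine sum_congr rfl fun σ _ => ?_
  rw [Units.smul_def, map_zsmul, mul_smul_comm, derivation_prod]
  congr 1
  have : ∀ k ∈ univ, (∏ j ∈ univ.erase k, M (σ j) j) * D (M (σ k) k)
      = (c k - r (σ k)) * ∏ j, M (σ j) j := by
    intro k hk
    rw [h, ← mul_prod_erase univ _ hk]
    ring
  rw [sum_congr rfl this, ← sum_mul, sum_sub_distrib, Equiv.sum_comp σ r]

variable (𝕜 : Type*) [Field 𝕜]

/-- The polynomials in `z = X 0` and `t = X 1` with generating function `exp (z l - t l ^ 2)`. -/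
noncomputable def hpoly : ℕ → MvPolynomial (Fin 2) 𝕜
  | 0 => 1
  | k + 1 => X 0 * hpoly k - 2 * X 1 * pderiv 0 (hpoly k)

theorem isHermiteSeq_hpoly : IsHermiteSeq (pderiv 0) (X 0) (X 1) (hpoly 𝕜) :=
  ⟨rfl, fun _ => rfl⟩

/-- The Wronskian of `hpoly m, …, hpoly (m + n - 1)`. -/
noncomputable def tau (m n : ℕ) : MvPolynomial (Fin 2) 𝕜 :=
  wr (pderiv 0) (fun j => hpoly 𝕜 (m + j)) n

variable {𝕜}

theorem pderiv_zero_X_one : pderiv (R := 𝕜) (0 : Fin 2) (X 1) = 0 :=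
  pderiv_X_of_ne (by decide)

theorem pderiv_one_X_zero : pderiv (R := 𝕜) (1 : Fin 2) (X 0) = 0 :=
  pderiv_X_of_ne (by decide)

theorem pderiv_zero_pderiv_one (p : MvPolynomial (Fin 2) 𝕜) :
    pderiv 0 (pderiv 1 p) = pderiv 1 (pderiv 0 p) := by
  have : ⁅(pderiv 0 : Derivation 𝕜 (MvPolynomial (Fin 2) 𝕜) _),
      (pderiv 1 : Derivation 𝕜 (MvPolynomial (Fin 2) 𝕜) _)⁆ = 0 := by
    apply derivation_ext
    intro i
    fin_cases i <;> simp [Derivation.commutator_apply]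
  have h := congrArg (fun D => D p) this
  simpa [Derivation.commutator_apply, sub_eq_zero] using h

/-- The Euler vector field `z ∂_z + 2 t ∂_t`. -/
noncomputable def euler : Derivation 𝕜 (MvPolynomial (Fin 2) 𝕜) (MvPolynomial (Fin 2) 𝕜) :=
  (X 0 : MvPolynomial (Fin 2) 𝕜) • pderiv 0 + (2 * X 1 : MvPolynomial (Fin 2) 𝕜) • pderiv 1

theorem euler_apply (p : MvPolynomial (Fin 2) 𝕜) :
    euler p = X 0 * pderiv 0 p + 2 * X 1 * pderiv 1 p := rfl

theorem euler_pderiv (p : MvPolynomial (Fin 2) 𝕜) :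
    euler (pderiv 0 p) = pderiv 0 (euler p) - pderiv 0 p := by
  simp only [euler_apply, map_add, Derivation.leibniz, smul_eq_mul, derivation_two,
    pderiv_zero_X_one, pderiv_X_self, pderiv_zero_pderiv_one]
  ring

theorem pderiv_one_hpoly (k : ℕ) :
    pderiv 1 (hpoly 𝕜 k) = -pderiv 0 (pderiv 0 (hpoly 𝕜 k)) := by
  induction k with
  | zero => simp [hpoly]
  | succ k ih =>
    simp only [hpoly, map_sub, map_add, Derivation.leibniz, smul_eq_mul, derivation_two,
      pderiv_zero_X_one, pderiv_one_X_zero, pderiv_X_self, ← pderiv_zero_pderiv_one, ih, map_neg,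
      Derivation.map_one_eq_zero, map_zero]
    ring

theorem euler_iterate_pderiv_hpoly (i k : ℕ) :
    euler ((pderiv 0)^[i] (hpoly 𝕜 k)) = ((k : MvPolynomial (Fin 2) 𝕜) - i)
      * (pderiv 0)^[i] (hpoly 𝕜 k) := by
  induction i with
  | zero =>
    have := (isHermiteSeq_hpoly 𝕜).ode (pderiv_X_self 0) pderiv_zero_X_one k
    rw [Function.iterate_zero_apply, euler_apply, pderiv_one_hpoly]
    linear_combination -this
  | succ i ih =>
    have h1 := (pderiv (R := 𝕜) (0 : Fin 2)).map_natCast k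
    have h2 := (pderiv (R := 𝕜) (0 : Fin 2)).map_natCast i
    rw [Function.iterate_succ_apply', euler_pderiv, ih, Derivation.leibniz, map_sub, h1, h2]
    push_cast
    simp only [smul_eq_mul]
    ring

/-- The entry in row i and column j has weight m + j - i. The sums over i and j cancel, leaving mn.
-/
theorem euler_tau (m n : ℕ) : euler (tau 𝕜 m n) = (m * n : ℕ) * tau 𝕜 m n := by
  rw [tau, wr, derivation_det_of_weights euler (Matrix.of _) (fun i : Fin n => ((i : ℕ) : MvPolynomial (Fin 2) 𝕜))
    (fun j : Fin n => ((m + j : ℕ) : MvPolynomial (Fin 2) 𝕜)) fun i j => euler_iterate_pderiv_hpoly _ _]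
  congr 1
  simp [sum_add_distrib]
  ring

section Scaling

variable (z t s : 𝕜)

theorem iterate_pderiv_hpoly (i k : ℕ) :
    (pderiv 0)^[i] (hpoly 𝕜 k) = (k.descFactorial i : MvPolynomial (Fin 2) 𝕜) * hpoly 𝕜 (k - i) := by
  induction i with
  | zero => simp
  | succ i ih =>
    have h1 := (pderiv (R := 𝕜) (0 : Fin 2)).map_natCast (k.descFactorial i)
    rw [Function.iterate_succ_apply', ih, Derivation.leibniz, h1, Nat.descFactorial_succ]
    rcases Nat.eq_zero_or_pos (k - i) with h | h
    · simp [h, hpoly]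
    · obtain ⟨l, hl⟩ := Nat.exists_eq_add_of_lt h
      rw [show k - (i + 1) = l by omega, show k - i = l + 1 by omega,
        (isHermiteSeq_hpoly 𝕜).derivation_succ (pderiv_X_self 0) pderiv_zero_X_one]
      push_cast
      simp only [smul_eq_mul]
      ring

theorem eval_hpoly_add_two (k : ℕ) : eval ![z, t] (hpoly 𝕜 (k + 2))
    = z * eval ![z, t] (hpoly 𝕜 (k + 1)) - 2 * (k + 1) * t * eval ![z, t] (hpoly 𝕜 k) := by
  rw [hpoly, (isHermiteSeq_hpoly 𝕜).derivation_succ (pderiv_X_self 0) pderiv_zero_X_one]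
  simp
  ring

theorem eval_hpoly_smul (k : ℕ) :
    eval ![s * z, s ^ 2 * t] (hpoly 𝕜 k) = s ^ k * eval ![z, t] (hpoly 𝕜 k) := by
  induction k using Nat.twoStepInduction with
  | zero => simp [hpoly]
  | one => simp [hpoly]
  | more k h1 h2 =>
    rw [eval_hpoly_add_two, eval_hpoly_add_two, h1, h2]
    ring

theorem eval_tau (m n : ℕ) : eval ![z, t] (tau 𝕜 m n)
    = (Matrix.of fun i j : Fin n => eval ![z, t] ((pderiv 0)^[i] (hpoly 𝕜 (m + j)))).det := by
  rw [tau, wr, RingHom.map_det]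
  rfl

/-- The scaling form of `euler_tau`. The row factors stay on the left so that neither division nor
truncated subtraction of exponents occurs. -/
theorem eval_tau_smul (m n : ℕ) :
    (∏ i : Fin n, s ^ (i : ℕ)) * eval ![s * z, s ^ 2 * t] (tau 𝕜 m n)
      = (∏ j : Fin n, s ^ (m + j)) * eval ![z, t] (tau 𝕜 m n) := by
  rw [eval_tau, eval_tau, ← Matrix.det_mul_column, ← Matrix.det_mul_row]
  congr 1
  ext i j
  simp only [Matrix.of_apply, iterate_pderiv_hpoly, map_mul, map_natCast, eval_hpoly_smul]
  by_cases h : (i : ℕ) ≤ m + j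
  · obtain ⟨l, hl⟩ := Nat.exists_eq_add_of_le h
    rw [hl, Nat.add_sub_cancel_left]
    ring
  · rw [Nat.descFactorial_of_lt (by omega)]
    simp

theorem eval_hpoly_one_zero (k : ℕ) : eval ![1, 0] (hpoly 𝕜 k) = 1 := by
  induction k using Nat.twoStepInduction with
  | zero => simp [hpoly]
  | one => simp [hpoly]
  | more k h1 h2 => simp [eval_hpoly_add_two, h1, h2]

/-- At t = 0 the polynomials are z^k, so at z = 1 the entries are falling factorials of m + j. These
are monic of degree i in m + j, and the determinant is the Vandermonde determinant of distinct
nodes. -/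
theorem eval_tau_one_zero [CharZero 𝕜] (m n : ℕ) : eval ![1, 0] (tau 𝕜 m n) ≠ 0 := by
  have h := Matrix.det_eval_matrixOfPolynomials_eq_det_vandermonde
    (fun j : Fin n => ((m + j : ℕ) : 𝕜)) (fun i => descPochhammer 𝕜 i)
    (fun i => descPochhammer_natDegree 𝕜 i) (fun i => monic_descPochhammer 𝕜 i)
  have h2 : eval ![1, 0] (tau 𝕜 m n)
      = (Matrix.vandermonde fun j : Fin n => ((m + j : ℕ) : 𝕜)).det := by
    rw [h, eval_tau, ← Matrix.det_transpose]
    congr 1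
    ext i j
    simp only [Matrix.transpose_apply, Matrix.of_apply, iterate_pderiv_hpoly, map_mul, map_natCast,
      eval_hpoly_one_zero, descPochhammer_eval_eq_descFactorial, mul_one]
  rw [h2, Matrix.det_vandermonde_ne_zero_iff]
  intro i j hij
  have := Nat.cast_injective hij
  exact Fin.ext (by omega)

theorem tau_ne_zero [CharZero 𝕜] (m n : ℕ) : tau 𝕜 m n ≠ 0 := by
  intro h
  apply eval_tau_one_zero (𝕜 := 𝕜) m n
  rw [h, map_zero]

theorem tauLevel_tau [CharZero 𝕜] (n : ℕ) :
    TauLevel (pderiv 0) (X 0) (X 1) (tau 𝕜) n :=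
  (isHermiteSeq_hpoly 𝕜).tauLevel (pderiv_X_self 0) pderiv_zero_X_one (X_ne_zero 1) tau_ne_zero n

theorem finite_setOf_eval_tau_eq_zero [CharZero 𝕜] (m n : ℕ) :
    {z : 𝕜 | eval ![z, t] (tau 𝕜 m n) = 0}.Finite := by
  have key : ∀ (a b : Polynomial 𝕜) (z : 𝕜), (aeval ![a, b] (tau 𝕜 m n)).eval z
      = eval ![a.eval z, b.eval z] (tau 𝕜 m n) := by
    intro a b z
    rw [← Polynomial.coe_evalRingHom, ← MvPolynomial.eval₂_id,
      MvPolynomial.aeval_def, MvPolynomial.hom_eval₂]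
    congr 1
    · ext; simp
    · ext i; fin_cases i <;> simp
  by_cases h0 : aeval ![Polynomial.X, Polynomial.C t] (tau 𝕜 m n) = 0
  · exfalso
    -- If tau vanished for all z at this t, scaling would make tau(1, t s²) vanish for every s ≠ 0,
    -- hence also at s = 0, against `eval_tau_one_zero`.
    have h1 : ∀ z, eval ![z, t] (tau 𝕜 m n) = 0 := by
      intro z
      have := key Polynomial.X (Polynomial.C t) z
      simpa [h0] using this.symm
    have h2 : aeval ![(1 : Polynomial 𝕜), Polynomial.C t * Polynomial.X ^ 2] (tau 𝕜 m n) = 0 := by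
      refine Polynomial.eq_zero_of_infinite_isRoot _
        (Set.Infinite.mono (s := {s : 𝕜 | s ≠ 0}) (fun s hs => ?_)
          (Set.finite_singleton (0 : 𝕜)).infinite_compl)
      have h3 := eval_tau_smul s⁻¹ t s m n
      rw [mul_comm (s ^ 2), h1, mul_zero, mul_inv_cancel₀ hs] at h3
      rw [Set.mem_ofPred_eq, Polynomial.IsRoot.def, key]
      simpa using (mul_eq_zero.mp h3).resolve_left
        (prod_ne_zero_iff.mpr fun i _ => pow_ne_zero _ hs)
    apply eval_tau_one_zero (𝕜 := 𝕜) m n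
    have h4 := key 1 (Polynomial.C t * Polynomial.X ^ 2) 0
    rw [h2] at h4
    simpa using h4.symm
  · refine (Polynomial.finite_setOfPred_isRoot h0).subset fun z hz => ?_
    rw [Set.mem_ofPred_eq, Polynomial.IsRoot.def, key]
    simpa using hz

end Scaling

end Polynomials

/-! ### Evaluation at z = x + 2κt and identification with φ and Φ -/

section Evaluation

open MvPolynomial

variable {𝕜 : Type*} [RCLike 𝕜]

/-- A polynomial in `z` and `t`, evaluated at `z = x + 2 κ t`. -/
noncomputable def ev (κ : 𝕜) (p : MvPolynomial (Fin 2) 𝕜) (q : 𝕜 × 𝕜) : 𝕜 :=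
  eval ![q.1 + 2 * κ * q.2, q.2] p

variable (κ : 𝕜) (p p' : MvPolynomial (Fin 2) 𝕜) (q : 𝕜 × 𝕜)

theorem ev_add : ev κ (p + p') q = ev κ p q + ev κ p' q := map_add _ _ _

theorem ev_sub : ev κ (p - p') q = ev κ p q - ev κ p' q := map_sub _ _ _

theorem ev_mul : ev κ (p * p') q = ev κ p q * ev κ p' q := map_mul _ _ _

theorem ev_X_zero : ev κ (X 0) q = q.1 + 2 * κ * q.2 := by simp [ev]

theorem ev_X_one : ev κ (X 1) q = q.2 := by simp [ev]

theorem ev_two : ev κ 2 q = 2 := by simp [ev]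

theorem ev_natCast (k : ℕ) : ev κ k q = k := by simp [ev]

theorem contDiff_ev : ContDiff 𝕜 ∞ (ev κ p) := by
  induction p using MvPolynomial.induction_on with
  | C a =>
    have h : ev κ (C a) = fun _ => a := funext fun q => by simp [ev]
    rw [h]
    exact contDiff_const
  | add p p' hp hp' =>
    rw [funext (ev_add κ p p')]
    exact hp.add hp'
  | mul_X p i hp =>
    rw [funext (ev_mul κ p (X i))]
    refine hp.mul ?_
    fin_cases i
    · change ContDiff 𝕜 ∞ (ev κ (X 0))
      rw [funext (ev_X_zero κ)]
      exact contDiff_fst.add (contDiff_const.mul contDiff_snd)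
    · change ContDiff 𝕜 ∞ (ev κ (X 1))
      rw [funext (ev_X_one κ)]
      exact contDiff_snd

variable (x t : 𝕜)

theorem hasDerivAt_ev_fst :
    HasDerivAt (fun y => ev κ p (y, t)) (ev κ (pderiv 0 p) (x, t)) x := by
  induction p using MvPolynomial.induction_on with
  | C a => simpa [ev] using hasDerivAt_const x a
  | add p p' hp hp' => simpa only [map_add, ev_add] using hp.fun_add hp'
  | mul_X p i hp =>
    have hX : HasDerivAt (fun y => ev κ (X i) (y, t)) (ev κ (pderiv 0 (X i)) (x, t)) x := by
      fin_cases i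
      · simpa [ev] using (hasDerivAt_id x).add_const (2 * κ * t)
      · simpa [ev, pderiv_zero_X_one] using hasDerivAt_const x t
    simp only [ev_mul, Derivation.leibniz, smul_eq_mul, ev_add]
    exact (hp.fun_mul hX).congr_deriv (by ring)

theorem hasDerivAt_ev_snd :
    HasDerivAt (fun s => ev κ p (x, s))
      (ev κ (pderiv 1 p) (x, t) + 2 * κ * ev κ (pderiv 0 p) (x, t)) t := by
  induction p using MvPolynomial.induction_on with
  | C a => simpa [ev] using hasDerivAt_const t a
  | add p p' hp hp' =>
    simp only [map_add, ev_add]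
    exact (hp.fun_add hp').congr_deriv (by ring)
  | mul_X p i hp =>
    have hX : HasDerivAt (fun s => ev κ (X i) (x, s))
        (ev κ (pderiv 1 (X i)) (x, t) + 2 * κ * ev κ (pderiv 0 (X i)) (x, t)) t := by
      fin_cases i
      · simpa [ev, pderiv_one_X_zero] using ((hasDerivAt_id t).const_mul (2 * κ)).const_add x
      · simpa [ev, pderiv_zero_X_one] using hasDerivAt_id' t
    simp only [ev_mul, Derivation.leibniz, smul_eq_mul, ev_add]
    exact (hp.fun_mul hX).congr_deriv (by ring)

theorem iteratedDeriv_ev (i : ℕ) :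
    iteratedDeriv i (fun y => ev κ p (y, t)) x = ev κ ((pderiv 0)^[i] p) (x, t) := by
  induction i generalizing x with
  | zero => simp
  | succ i ih =>
    rw [iteratedDeriv_succ, funext ih, Function.iterate_succ_apply']
    exact (hasDerivAt_ev_fst κ _ x t).deriv

theorem hasDerivAt_normedSpace_exp {f : 𝕜 → 𝕜} {f' y : 𝕜} (hf : HasDerivAt f f' y) :
    HasDerivAt (fun y => NormedSpace.exp (f y)) (NormedSpace.exp (f y) * f') y :=
  (hasDerivAt_exp (𝕂 := 𝕜) (x := f y)).comp y hf

/-- The recursion defining `hpoly` is the product rule at z - 2tl: the exponential contributes this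
factor and the chain rule contributes -2t ∂_z. The induction needs all l, although only l = 0 is
used later. -/
theorem iteratedDeriv_exp_quadratic (z : 𝕜) (k : ℕ) :
    iteratedDeriv k (fun l : 𝕜 => NormedSpace.exp (z * l - t * l ^ 2))
      = fun l => ev 0 (hpoly 𝕜 k) (z - 2 * t * l, t) * NormedSpace.exp (z * l - t * l ^ 2) := by
  induction k with
  | zero => simp [hpoly, ev]
  | succ k ih =>
    rw [iteratedDeriv_succ, ih]
    ext l
    have h1 : HasDerivAt (fun l : 𝕜 => z * l - t * l ^ 2) (z - 2 * t * l) l := by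
      refine (((hasDerivAt_id' l).const_mul z).fun_sub
        (((hasDerivAt_id' l).fun_pow 2).const_mul t)).congr_deriv ?_
      simp
      ring
    have h2 : HasDerivAt (fun l : 𝕜 => z - 2 * t * l) (-(2 * t)) l := by
      simpa using ((hasDerivAt_id l).const_mul (2 * t)).const_sub z
    have h3 := (hasDerivAt_ev_fst 0 (hpoly 𝕜 k) (z - 2 * t * l) t).comp l h2
    refine ((h3.mul (hasDerivAt_normedSpace_exp h1)).congr_deriv ?_).deriv
    simp only [hpoly, ev_sub, ev_mul, ev_X_zero, ev_X_one, ev_two, Function.comp_apply]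
    ring

theorem phi_eq_ev (k : ℕ) : phi k x t κ = ev κ (hpoly 𝕜 k) (x, t) := by
  rw [phi, iteratedDeriv_exp_quadratic]
  simp [ev]

theorem Phi_eq_ev (m n : ℕ) : Phi m n x t κ = ev κ (tau 𝕜 m n) (x, t) := by
  rw [Phi, wronskian, ev, eval_tau]
  congr 1
  ext i j
  simp only [Matrix.of_apply, phi_eq_ev, iteratedDeriv_ev]
  rfl

theorem finite_setOf_Phi_eq_zero (m n : ℕ) : {x : 𝕜 | Phi m n x t κ = 0}.Finite := by
  refine ((finite_setOf_eval_tau_eq_zero t m n).preimage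
    (add_left_injective (2 * κ * t)).injOn).subset fun x hx => ?_
  rw [Set.mem_ofPred_eq, Phi_eq_ev] at hx
  exact hx

theorem euler_ev_tau (m n : ℕ) :
    (x + 2 * κ * t) * ev κ (pderiv 0 (tau 𝕜 m n)) (x, t)
        + 2 * t * ev κ (pderiv 1 (tau 𝕜 m n)) (x, t)
      = m * n * ev κ (tau 𝕜 m n) (x, t) := by
  have h := congrArg (fun p => ev κ p (x, t)) (euler_tau (𝕜 := 𝕜) m n)
  simpa [euler_apply, ev_add, ev_mul, ev_X_zero, ev_X_one, ev_two, ev_natCast] using h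

theorem euler_ev_pderiv_tau (m n : ℕ) :
    (x + 2 * κ * t) * ev κ (pderiv 0 (pderiv 0 (tau 𝕜 m n))) (x, t)
        + 2 * t * ev κ (pderiv 1 (pderiv 0 (tau 𝕜 m n))) (x, t)
      = (m * n - 1) * ev κ (pderiv 0 (tau 𝕜 m n)) (x, t) := by
  have h0 := euler_pderiv (tau 𝕜 m n)
  have h1 := (pderiv (R := 𝕜) (0 : Fin 2)).map_natCast (m * n)
  rw [euler_tau, Derivation.leibniz, h1, smul_zero, add_zero, smul_eq_mul, ← sub_one_mul] at h0
  have h := congrArg (fun p => ev κ p (x, t)) h0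
  simpa [euler_apply, ev_add, ev_sub, ev_mul, ev_X_zero, ev_X_one, ev_two, ev_natCast,
    (by simp [ev] : ev κ 1 (x, t) = 1)] using h

end Evaluation

/-! ### Hermite polynomials and the generating function -/

section Hermite

variable {𝕜 : Type*} [RCLike 𝕜]

theorem iteratedDeriv_exp_neg_sq (k : ℕ) :
    iteratedDeriv k (fun y : 𝕜 => NormedSpace.exp (-y ^ 2))
      = fun y => (-1) ^ k * ev 0 (hpoly 𝕜 k) (2 * y, 1) * NormedSpace.exp (-y ^ 2) := by
  induction k with
  | zero => simp [hpoly, ev]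
  | succ k ih =>
    rw [iteratedDeriv_succ, ih]
    ext y
    have h1 : HasDerivAt (fun y : 𝕜 => -y ^ 2) (-(2 * y)) y := by
      simpa using ((hasDerivAt_id' y).fun_pow 2).fun_neg
    have h2 : HasDerivAt (fun y : 𝕜 => 2 * y) 2 y := by
      simpa using (hasDerivAt_id y).const_mul (2 : 𝕜)
    have h3 := ((hasDerivAt_ev_fst 0 (hpoly 𝕜 k) (2 * y) 1).comp y h2).const_mul ((-1) ^ k)
    refine ((h3.mul (hasDerivAt_normedSpace_exp h1)).congr_deriv ?_).deriv
    simp only [hpoly, ev_sub, ev_mul, ev_X_zero, ev_X_one, ev_two, Function.comp_apply]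
    ring

theorem hermiteH_eq_ev (k : ℕ) (y : 𝕜) : hermiteH k y = ev 0 (hpoly 𝕜 k) (2 * y, 1) := by
  have h : NormedSpace.exp (y ^ 2) * NormedSpace.exp (-y ^ 2) = 1 := by
    rw [← NormedSpace.exp_add_of_commute (Commute.all _ _), add_neg_cancel, NormedSpace.exp_zero]
  have h' : ((-1 : 𝕜) ^ k) * (-1) ^ k = 1 := by rw [← mul_pow]; simp
  rw [hermiteH, iteratedDeriv_exp_neg_sq]
  linear_combination ev 0 (hpoly 𝕜 k) (2 * y, 1) * ((-1) ^ k * (-1) ^ k * h + h')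

/-- H_k(y) is `hpoly k` at (2y, 1); scaling by s carries this point to (2sy, s²). -/
theorem phi_eq_hermiteH (κ x t s : 𝕜) (hs : s ^ 2 = t) (ht : t ≠ 0) (k : ℕ) :
    phi k x t κ = s ^ k * hermiteH k ((x + 2 * κ * t) / (2 * s)) := by
  have hs0 : s ≠ 0 := by
    rintro rfl
    exact ht (by rw [← hs]; simp)
  have h := eval_hpoly_smul (2 * ((x + 2 * κ * t) / (2 * s))) 1 s k
  have e1 : s * (2 * ((x + 2 * κ * t) / (2 * s))) = x + 2 * κ * t := by
    field_simp
  rw [e1, hs, mul_one] at h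
  rw [phi_eq_ev, hermiteH_eq_ev]
  simpa [ev] using h

theorem phi_eq_rpow_mul_hermiteH (κ x t : ℝ) (ht : 0 < t) (k : ℕ) :
    phi k x t κ = t ^ ((k : ℝ) / 2) * hermiteH k ((x + 2 * κ * t) / Real.sqrt (4 * t)) := by
  have h4 : Real.sqrt (4 * t) = 2 * Real.sqrt t := by
    rw [Real.sqrt_mul (by norm_num), show (4 : ℝ) = 2 ^ 2 by norm_num, Real.sqrt_sq (by norm_num)]
  rw [phi_eq_hermiteH κ x t (Real.sqrt t) (Real.sq_sqrt ht.le) ht.ne', h4, Real.sqrt_eq_rpow,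
    ← Real.rpow_natCast, ← Real.rpow_mul ht.le]
  congr 2
  ring

theorem hasSum_phi_complex (κ x t l : ℂ) :
    HasSum (fun k : ℕ => phi k x t κ * l ^ k / (k.factorial : ℂ))
      (Complex.exp ((x + 2 * κ * t) * l - t * l ^ 2)) := by
  have h := Complex.hasSum_taylorSeries_of_entire
    (f := fun l => NormedSpace.exp ((x + 2 * κ * t) * l - t * l ^ 2))
    (by rw [← Complex.exp_eq_exp_ℂ]; fun_prop) 0 l
  rw [Complex.exp_eq_exp_ℂ]
  refine Eq.mp (congrArg (fun f => HasSum f _) (funext fun k => ?_)) h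
  rw [smul_eq_mul, smul_eq_mul, sub_zero]
  unfold phi
  ring

theorem ofReal_phi (κ x t : ℝ) (k : ℕ) : ((phi k x t κ : ℝ) : ℂ) = phi k (x : ℂ) t κ := by
  simp only [phi_eq_ev, ev]
  induction k using Nat.twoStepInduction with
  | zero => simp [hpoly]
  | one => simp [hpoly]
  | more k h1 h2 =>
    rw [eval_hpoly_add_two, eval_hpoly_add_two, ← h1, ← h2]
    push_cast
    ring

theorem hasSum_phi_real (κ x t l : ℝ) :
    HasSum (fun k : ℕ => phi k x t κ * l ^ k / (k.factorial : ℝ))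
      (Real.exp ((x + 2 * κ * t) * l - t * l ^ 2)) := by
  rw [← Complex.hasSum_ofReal]
  have h := hasSum_phi_complex κ x t l
  simpa [← ofReal_phi] using h

end Hermite

open scoped Topology

/-! ### Partial derivatives, extension by density, and the reduction to Painlevé IV -/

section Calculus

variable {𝕜 : Type*} [RCLike 𝕜] {Ω : Set (𝕜 × 𝕜)}

theorem eventually_slice_fst (hΩ : IsOpen Ω) {x t : 𝕜} (h : (x, t) ∈ Ω) :
    ∀ᶠ y in 𝓝 x, (y, t) ∈ Ω :=
  (Continuous.prodMk_left t).continuousAt.eventually (hΩ.mem_nhds h)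

theorem eventually_slice_snd (hΩ : IsOpen Ω) {x t : 𝕜} (h : (x, t) ∈ Ω) :
    ∀ᶠ s in 𝓝 t, (x, s) ∈ Ω :=
  (Continuous.prodMk_right x).continuousAt.eventually (hΩ.mem_nhds h)

/-- Directional derivative of a function of two variables. -/
noncomputable def dirDeriv (v : 𝕜 × 𝕜) (f : 𝕜 × 𝕜 → 𝕜) (p : 𝕜 × 𝕜) : 𝕜 :=
  fderiv 𝕜 f p v

theorem contDiffOn_dirDeriv (hΩ : IsOpen Ω) {f : 𝕜 × 𝕜 → 𝕜} (hf : ContDiffOn 𝕜 ∞ f Ω)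
    (v : 𝕜 × 𝕜) : ContDiffOn 𝕜 ∞ (dirDeriv v f) Ω :=
  (hf.fderiv_of_isOpen hΩ (by simp)).clm_apply contDiffOn_const

theorem contDiffOn_iterate_dirDeriv (hΩ : IsOpen Ω) {f : 𝕜 × 𝕜 → 𝕜} (hf : ContDiffOn 𝕜 ∞ f Ω)
    (v : 𝕜 × 𝕜) (k : ℕ) : ContDiffOn 𝕜 ∞ ((dirDeriv v)^[k] f) Ω := by
  induction k with
  | zero => exact hf
  | succ k ih =>
    rw [Function.iterate_succ_apply']
    exact contDiffOn_dirDeriv hΩ ih v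

theorem hasDerivAt_fst_of_hasFDerivAt {f : 𝕜 × 𝕜 → 𝕜} {f' : 𝕜 × 𝕜 →L[𝕜] 𝕜} {x t : 𝕜}
    (hf : HasFDerivAt f f' (x, t)) : HasDerivAt (fun y => f (y, t)) (f' (1, 0)) x :=
  hf.comp_hasDerivAt x ((hasDerivAt_id' x).prodMk (hasDerivAt_const x t))

theorem hasDerivAt_snd_of_hasFDerivAt {f : 𝕜 × 𝕜 → 𝕜} {f' : 𝕜 × 𝕜 →L[𝕜] 𝕜} {x t : 𝕜}
    (hf : HasFDerivAt f f' (x, t)) : HasDerivAt (fun s => f (x, s)) (f' (0, 1)) t :=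
  hf.comp_hasDerivAt t ((hasDerivAt_const t x).prodMk (hasDerivAt_id' t))

theorem hasFDerivAt_of_contDiffOn (hΩ : IsOpen Ω) {f : 𝕜 × 𝕜 → 𝕜} (hf : ContDiffOn 𝕜 ∞ f Ω)
    {p : 𝕜 × 𝕜} (hp : p ∈ Ω) : HasFDerivAt f (fderiv 𝕜 f p) p :=
  ((hf.contDiffAt (hΩ.mem_nhds hp)).differentiableAt (by simp)).hasFDerivAt

theorem iteratedDeriv_slice_fst (hΩ : IsOpen Ω) {f : 𝕜 × 𝕜 → 𝕜} (hf : ContDiffOn 𝕜 ∞ f Ω) (k : ℕ)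
    {x t : 𝕜} (h : (x, t) ∈ Ω) :
    iteratedDeriv k (fun y => f (y, t)) x = (dirDeriv (1, 0))^[k] f (x, t) := by
  induction k generalizing x with
  | zero => simp
  | succ k ih =>
    have e : iteratedDeriv k (fun y => f (y, t)) =ᶠ[𝓝 x]
        fun y => (dirDeriv (1, 0))^[k] f (y, t) :=
      (eventually_slice_fst hΩ h).mono fun y hy => ih hy
    rw [iteratedDeriv_succ, e.deriv_eq, Function.iterate_succ_apply']
    exact (hasDerivAt_fst_of_hasFDerivAt (hasFDerivAt_of_contDiffOn hΩ
      (contDiffOn_iterate_dirDeriv hΩ hf _ k) h)).deriv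

theorem iteratedDeriv_slice_snd (hΩ : IsOpen Ω) {f : 𝕜 × 𝕜 → 𝕜} (hf : ContDiffOn 𝕜 ∞ f Ω) (k : ℕ)
    {x t : 𝕜} (h : (x, t) ∈ Ω) :
    iteratedDeriv k (fun s => f (x, s)) t = (dirDeriv (0, 1))^[k] f (x, t) := by
  induction k generalizing t with
  | zero => simp
  | succ k ih =>
    have e : iteratedDeriv k (fun s => f (x, s)) =ᶠ[𝓝 t]
        fun s => (dirDeriv (0, 1))^[k] f (x, s) :=
      (eventually_slice_snd hΩ h).mono fun s hs => ih hs
    rw [iteratedDeriv_succ, e.deriv_eq, Function.iterate_succ_apply']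
    exact (hasDerivAt_snd_of_hasFDerivAt (hasFDerivAt_of_contDiffOn hΩ
      (contDiffOn_iterate_dirDeriv hΩ hf _ k) h)).deriv

/-- The left-hand side of the dispersive water wave equation. -/
noncomputable def dwwExpr (U : 𝕜 → 𝕜 → 𝕜) (x t : 𝕜) : 𝕜 :=
  iteratedDeriv 2 (fun s => U x s) t
    + 2 * deriv (fun s => U x s) t * iteratedDeriv 2 (fun y => U y t) x
    + 4 * deriv (fun y => U y t) x * deriv (fun s => deriv (fun y => U y s) x) t
    + 6 * (deriv (fun y => U y t) x) ^ 2 * iteratedDeriv 2 (fun y => U y t) x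
    - iteratedDeriv 4 (fun y => U y t) x

theorem continuousOn_dwwExpr (hΩ : IsOpen Ω) {U : 𝕜 → 𝕜 → 𝕜}
    (hU : ContDiffOn 𝕜 ∞ (fun p : 𝕜 × 𝕜 => U p.1 p.2) Ω) :
    ContinuousOn (fun p : 𝕜 × 𝕜 => dwwExpr U p.1 p.2) Ω := by
  set f : 𝕜 × 𝕜 → 𝕜 := fun p => U p.1 p.2
  have hx : ∀ {x t : 𝕜}, (x, t) ∈ Ω →
      deriv (fun y => U y t) x = (dirDeriv (1, 0))^[1] f (x, t) := fun {x t} h => by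
    rw [← iteratedDeriv_slice_fst hΩ hU 1 h, iteratedDeriv_one]
  have key : Set.EqOn (fun p : 𝕜 × 𝕜 => dwwExpr U p.1 p.2) (fun p =>
      (dirDeriv (0, 1))^[2] f p + 2 * (dirDeriv (0, 1))^[1] f p * (dirDeriv (1, 0))^[2] f p
      + 4 * (dirDeriv (1, 0))^[1] f p * (dirDeriv (0, 1))^[1] ((dirDeriv (1, 0))^[1] f) p
      + 6 * ((dirDeriv (1, 0))^[1] f p) ^ 2 * (dirDeriv (1, 0))^[2] f p
      - (dirDeriv (1, 0))^[4] f p) Ω := by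
    rintro ⟨x, t⟩ h
    have e : (fun s => deriv (fun y => U y s) x) =ᶠ[𝓝 t]
        fun s => (dirDeriv (1, 0))^[1] f (x, s) :=
      (eventually_slice_snd hΩ h).mono fun s hs => hx hs
    simp only [dwwExpr]
    rw [hx h, e.deriv_eq, ← iteratedDeriv_one (f := fun s => (dirDeriv (1, 0))^[1] f (x, s)),
      iteratedDeriv_slice_snd hΩ (contDiffOn_iterate_dirDeriv hΩ hU (1, 0) 1) 1 h,
      ← iteratedDeriv_slice_fst hΩ hU 2 h, ← iteratedDeriv_slice_fst hΩ hU 4 h,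
      ← iteratedDeriv_slice_snd hΩ hU 2 h, ← iteratedDeriv_slice_snd hΩ hU 1 h, iteratedDeriv_one]
  refine ContinuousOn.congr ?_ key
  have c := fun v k => (contDiffOn_iterate_dirDeriv hΩ hU v k).continuousOn
  have c₁ := c (1, 0) 1
  have c₂ := c (1, 0) 2
  have c₄ := c (1, 0) 4
  have b₁ := c (0, 1) 1
  have b₂ := c (0, 1) 2
  have b := (contDiffOn_iterate_dirDeriv hΩ
    (contDiffOn_iterate_dirDeriv hΩ hU (1, 0) 1) (0, 1) 1).continuousOn
  clear c key hx
  generalize (dirDeriv (0, 1))^[1] ((dirDeriv (1, 0))^[1] f) = F at b ⊢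
  generalize (dirDeriv (1, 0))^[1] f = F₁ at c₁ ⊢
  generalize (dirDeriv (1, 0))^[2] f = F₂ at c₂ ⊢
  generalize (dirDeriv (1, 0))^[4] f = F₄ at c₄ ⊢
  generalize (dirDeriv (0, 1))^[1] f = E₁ at b₁ ⊢
  generalize (dirDeriv (0, 1))^[2] f = E₂ at b₂ ⊢
  fun_prop

theorem eq_zero_of_dense (hΩ : IsOpen Ω) {f : 𝕜 × 𝕜 → 𝕜} (hf : ContinuousOn f Ω)
    {G : Set (𝕜 × 𝕜)} (hG : Dense G) (h : ∀ p ∈ Ω ∩ G, f p = 0) : ∀ p ∈ Ω, f p = 0 := by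
  have hs : Ω ⊆ closure (Ω ∩ G) := hG.open_subset_closure_inter hΩ
  have h1 : Set.EqOn f (fun _ => 0) (Ω ∩ G) := h
  exact h1.of_subset_closure hf continuousOn_const Set.inter_subset_left hs

theorem isDWWSolutionOn_of_dense (hΩ : IsOpen Ω) {U : 𝕜 → 𝕜 → 𝕜}
    (hU : ContDiffOn 𝕜 ∞ (fun p : 𝕜 × 𝕜 => U p.1 p.2) Ω) {G : Set (𝕜 × 𝕜)} (hG : Dense G)
    (h : ∀ x t, (x, t) ∈ Ω ∩ G → dwwExpr U x t = 0) : IsDWWSolutionOn Ω U := by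
  refine ⟨hΩ, hU, fun x t hxt => ?_⟩
  have h2 := eq_zero_of_dense hΩ (continuousOn_dwwExpr hΩ hU) hG (fun p hp => h p.1 p.2 hp) _ hxt
  unfold dwwExpr at h2
  exact h2

/-- A potential whose `x`-derivative is built from a solution of the symmetric form of the fourth
Painlevé equation satisfies the dispersive water wave equation. -/
theorem dwwExpr_eq_zero_of_symmetric (hΩ : IsOpen Ω) {U g₁ g₂ g₃ : 𝕜 → 𝕜 → 𝕜} {κ a₁ a₂ a₃ : 𝕜}
    (ha : a₁ + a₂ + a₃ = 1)
    (ht : ∀ x t, (x, t) ∈ Ω → t ≠ 0)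
    (hsum : ∀ x t, (x, t) ∈ Ω → 2 * t * (g₁ x t + g₂ x t + g₃ x t) = x + 2 * κ * t)
    (h₁ : ∀ x t, (x, t) ∈ Ω → HasDerivAt (fun y => g₁ y t)
      (g₁ x t * (g₂ x t - g₃ x t) + a₁ / (2 * t)) x)
    (h₂ : ∀ x t, (x, t) ∈ Ω → HasDerivAt (fun y => g₂ y t)
      (g₂ x t * (g₃ x t - g₁ x t) + a₂ / (2 * t)) x)
    (h₃ : ∀ x t, (x, t) ∈ Ω → HasDerivAt (fun y => g₃ y t)
      (g₃ x t * (g₁ x t - g₂ x t) + a₃ / (2 * t)) x)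
    (hgt : ∀ x t, (x, t) ∈ Ω → HasDerivAt (fun s => g₁ x s)
      (2 * κ * (g₁ x t * (g₂ x t - g₃ x t) + a₁ / (2 * t)) - (g₁ x t + (x + 2 * κ * t) *
        (g₁ x t * (g₂ x t - g₃ x t) + a₁ / (2 * t))) / (2 * t)) t)
    (hUx : ∀ x t, (x, t) ∈ Ω → HasDerivAt (fun y => U y t)
      ((x + 2 * κ * t) / (2 * t) - g₁ x t - κ) x)
    (hUt : ∀ x t, (x, t) ∈ Ω → HasDerivAt (fun s => U x s)
      ((a₂ - a₃ - (x + 2 * κ * t) * ((x + 2 * κ * t) / (2 * t) - g₁ x t)) / (2 * t)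
        + 2 * κ * ((x + 2 * κ * t) / (2 * t) - g₁ x t) - κ ^ 2) t)
    {x t : 𝕜} (hxt : (x, t) ∈ Ω) : dwwExpr U x t = 0 := by
  have e1 : ∀ {x t}, (x, t) ∈ Ω → deriv (fun y => U y t) =ᶠ[𝓝 x]
      fun y => (y + 2 * κ * t) / (2 * t) - g₁ y t - κ := fun {x t} h =>
    (eventually_slice_fst hΩ h).mono fun y hy => (hUx y t hy).deriv
  have hz : ∀ x t : 𝕜, HasDerivAt (fun y => (y + 2 * κ * t) / (2 * t)) (1 / (2 * t)) x :=
    fun x t => ((hasDerivAt_id' x).add_const (2 * κ * t)).div_const (2 * t)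
  have d2 : ∀ {x t}, (x, t) ∈ Ω → iteratedDeriv 2 (fun y => U y t) x
      = 1 / (2 * t) - (g₁ x t * (g₂ x t - g₃ x t) + a₁ / (2 * t)) := fun {x t} h => by
    rw [iteratedDeriv_succ, iteratedDeriv_one, (e1 h).deriv_eq]
    exact (((hz x t).fun_sub (h₁ x t h)).sub_const κ).deriv
  have d3 : ∀ {x t}, (x, t) ∈ Ω → iteratedDeriv 3 (fun y => U y t) x
      = -((g₁ x t * (g₂ x t - g₃ x t) + a₁ / (2 * t)) * (g₂ x t - g₃ x t)
        + g₁ x t * ((g₂ x t * (g₃ x t - g₁ x t) + a₂ / (2 * t))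
          - (g₃ x t * (g₁ x t - g₂ x t) + a₃ / (2 * t)))) := fun {x t} h => by
    have e2 : iteratedDeriv 2 (fun y => U y t) =ᶠ[𝓝 x]
        fun y => 1 / (2 * t) - (g₁ y t * (g₂ y t - g₃ y t) + a₁ / (2 * t)) :=
      (eventually_slice_fst hΩ h).mono fun y hy => d2 hy
    rw [iteratedDeriv_succ, e2.deriv_eq]
    exact ((((h₁ x t h).fun_mul ((h₂ x t h).fun_sub (h₃ x t h))).add_const _).const_sub _).deriv
  have k₁ := h₁ x t hxt
  have k₂ := h₂ x t hxt
  have k₃ := h₃ x t hxt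
  have k := hgt x t hxt
  have d4 : iteratedDeriv 4 (fun y => U y t) x = deriv (fun y =>
      -((g₁ y t * (g₂ y t - g₃ y t) + a₁ / (2 * t)) * (g₂ y t - g₃ y t)
      + g₁ y t * ((g₂ y t * (g₃ y t - g₁ y t) + a₂ / (2 * t))
        - (g₃ y t * (g₁ y t - g₂ y t) + a₃ / (2 * t))))) x := by
    rw [iteratedDeriv_succ]
    exact Filter.EventuallyEq.deriv_eq
      ((eventually_slice_fst hΩ hxt).mono fun y hy => d3 hy)
  have ht0 := ht x t hxt
  have h2t : (2 * t : 𝕜) ≠ 0 := mul_ne_zero two_ne_zero ht0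
  have hzt : HasDerivAt (fun s => (x + 2 * κ * s) / (2 * s))
      (2 * κ / (2 * t) - (x + 2 * κ * t) / (2 * t ^ 2)) t := by
    refine ((((hasDerivAt_id' t).const_mul (2 * κ)).const_add x).fun_div
      ((hasDerivAt_id' t).const_mul 2) h2t).congr_deriv ?_
    field_simp
  have dxt : deriv (fun s => deriv (fun y => U y s) x) t
      = deriv (fun s => (x + 2 * κ * s) / (2 * s) - g₁ x s - κ) t :=
    Filter.EventuallyEq.deriv_eq
      ((eventually_slice_snd hΩ hxt).mono fun s hs => (hUx x s hs).deriv)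
  have dtt : iteratedDeriv 2 (fun s => U x s) t = deriv (fun s =>
      ((a₂ - a₃ - (x + 2 * κ * s) * ((x + 2 * κ * s) / (2 * s) - g₁ x s)) / (2 * s)
      + 2 * κ * ((x + 2 * κ * s) / (2 * s) - g₁ x s) - κ ^ 2)) t := by
    rw [iteratedDeriv_succ, iteratedDeriv_one]
    exact Filter.EventuallyEq.deriv_eq
      ((eventually_slice_snd hΩ hxt).mono fun s hs => (hUt x s hs).deriv)
  have l := ((hasDerivAt_id' t).const_mul (2 * κ)).const_add x
  have d4' := (((((k₁.fun_mul (k₂.fun_sub k₃)).add_const (a₁ / (2 * t))).fun_mul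
    (k₂.fun_sub k₃)).fun_add (k₁.fun_mul
      (((k₂.fun_mul (k₃.fun_sub k₁)).add_const (a₂ / (2 * t))).fun_sub
        ((k₃.fun_mul (k₁.fun_sub k₂)).add_const (a₃ / (2 * t)))))).fun_neg).deriv
  have dxt' := ((hzt.fun_sub k).sub_const κ).deriv
  have dtt' := (((((l.fun_mul (hzt.fun_sub k)).const_sub (a₂ - a₃)).fun_div
    ((hasDerivAt_id' t).const_mul 2) h2t).fun_add
    ((hzt.fun_sub k).const_mul (2 * κ))).sub_const (κ ^ 2)).deriv
  rw [dwwExpr, d4, d2 hxt, dxt, dtt, (hUx x t hxt).deriv, (hUt x t hxt).deriv, d4', dxt', dtt']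
  have hs := hsum x t hxt
  generalize g₁ x t = A at hs ⊢
  generalize g₂ x t = B at hs ⊢
  generalize g₃ x t = C at hs ⊢
  -- With a₃ and z eliminated through the two sum conditions, a rational identity in the g_i, t, κ,
  -- a₁ and a₂ remains.
  obtain rfl : a₃ = 1 - a₁ - a₂ := by linear_combination ha
  obtain ⟨z, hz⟩ : ∃ z, z = x + 2 * κ * t := ⟨_, rfl⟩
  rw [← hz] at hs ⊢
  subst hs
  field_simp
  ring

end Calculus

/-! ### From bilinear equations to the symmetric Painlevé system -/

section Triangle

open MvPolynomial

variable {𝕜 : Type*} [RCLike 𝕜] (κ : 𝕜)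

/-- The logarithmic `x`-derivative of a polynomial in `z = x + 2 κ t` and `t`. -/
noncomputable def logd (p : MvPolynomial (Fin 2) 𝕜) (x t : 𝕜) : 𝕜 :=
  ev κ (pderiv 0 p) (x, t) / ev κ p (x, t)

/-- The `x`-derivative of `logd`. -/
noncomputable def logd' (p : MvPolynomial (Fin 2) 𝕜) (x t : 𝕜) : 𝕜 :=
  ev κ (pderiv 0 (pderiv 0 p)) (x, t) / ev κ p (x, t) - logd κ p x t ^ 2

variable {κ} {x t : 𝕜} {p p' : MvPolynomial (Fin 2) 𝕜}

theorem hasDerivAt_logd_fst (hp : ev κ p (x, t) ≠ 0) :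
    HasDerivAt (fun y => logd κ p y t) (logd' κ p x t) x := by
  refine ((hasDerivAt_ev_fst κ (pderiv 0 p) x t).fun_div (hasDerivAt_ev_fst κ p x t)
    hp).congr_deriv ?_
  rw [logd', logd]
  field_simp

/-- The logarithmic derivative of a homogeneous polynomial has weight -1, which fixes ∂_t at
constant z; the 2κ term comes from z = x + 2κt. -/
theorem hasDerivAt_logd_tau_snd {m n : ℕ} (ht : t ≠ 0) (hp : ev κ (tau 𝕜 m n) (x, t) ≠ 0) :
    HasDerivAt (fun s => logd κ (tau 𝕜 m n) x s)
      (2 * κ * logd' κ (tau 𝕜 m n) x t - (logd κ (tau 𝕜 m n) x t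
        + (x + 2 * κ * t) * logd' κ (tau 𝕜 m n) x t) / (2 * t)) t := by
  have h0 := euler_ev_tau κ x t m n
  have h1 := euler_ev_pderiv_tau κ x t m n
  refine ((hasDerivAt_ev_snd κ (pderiv 0 (tau 𝕜 m n)) x t).fun_div
    (hasDerivAt_ev_snd κ (tau 𝕜 m n) x t) hp).congr_deriv ?_
  rw [logd', logd]
  generalize ev κ (tau 𝕜 m n) (x, t) = A at *
  generalize ev κ (pderiv 0 (tau 𝕜 m n)) (x, t) = A₁ at *
  generalize ev κ (pderiv 0 (pderiv 0 (tau 𝕜 m n))) (x, t) = A₂ at *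
  generalize ev κ (pderiv 1 (tau 𝕜 m n)) (x, t) = E at *
  generalize ev κ (pderiv 1 (pderiv 0 (tau 𝕜 m n))) (x, t) = E₁ at *
  field_simp
  linear_combination A * h1 - A₁ * h0

/-- Division by FG turns D_x² F·G into (ln F)'' + (ln G)'' + ((ln F)' - (ln G)')². -/
theorem BilinearEq.logd {c : MvPolynomial (Fin 2) 𝕜} {c' : 𝕜}
    (h : BilinearEq (pderiv 0) (X 0) (X 1) c p p') (hc : ev κ c (x, t) = c')
    (hp : ev κ p (x, t) ≠ 0) (hp' : ev κ p' (x, t) ≠ 0) :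
    2 * t * (logd' κ p x t + logd' κ p' x t + (logd κ p x t - logd κ p' x t) ^ 2)
      + (x + 2 * κ * t) * (logd κ p x t - logd κ p' x t) + c' = 0 := by
  have h1 := congrArg (fun p => ev κ p (x, t)) h
  simp only [ev_add, ev_sub, ev_mul, ev_X_zero, ev_X_one, ev_two, hc,
    (by simp [ev] : ev κ 0 (x, t) = 0)] at h1
  simp only [logd', DWW.logd]
  field_simp
  linear_combination ev κ p (x, t) * ev κ p' (x, t) * h1

/-- With a, b, c the logarithmic derivatives at (m,n), (m+1,n), (m,n+1), each equation of the system
is a difference of two bilinear ones. -/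
theorem symmetric_of_bilinear {K : Type*} [Field K] [CharZero K] {t z m n a b c a' b' c' : K}
    (ht : t ≠ 0)
    (h₁ : 2 * t * (b' + a' + (b - a) ^ 2) + z * (b - a) + -n = 0)
    (h₂ : 2 * t * (a' + c' + (a - c) ^ 2) + z * (a - c) + m = 0)
    (h₃ : 2 * t * (b' + c' + (b - c) ^ 2) + z * (b - c) + (m - n) = 0) :
    a' - b' = (a - b) * ((c - a) - (z / (2 * t) - c + b)) + -n / (2 * t) ∧
    c' - a' = (c - a) * ((z / (2 * t) - c + b) - (a - b)) + -m / (2 * t) ∧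
    1 / (2 * t) - c' + b'
      = (z / (2 * t) - c + b) * ((a - b) - (c - a)) + (m + n + 1) / (2 * t) := by
  refine ⟨?_, ?_, ?_⟩
  · field_simp
    linear_combination h₂ - h₃
  · field_simp
    linear_combination h₃ - h₁
  · field_simp
    linear_combination h₁ - h₂

variable (κ)

/-- The points at which the three tau functions of the triangle at `(m, n)` and `t` are nonzero. -/
def genericSet (m n : ℕ) : Set (𝕜 × 𝕜) :=
  {q | q.2 ≠ 0 ∧ ev κ (tau 𝕜 m n) q ≠ 0 ∧ ev κ (tau 𝕜 (m + 1) n) q ≠ 0 ∧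
    ev κ (tau 𝕜 m (n + 1)) q ≠ 0}

theorem isOpen_genericSet (m n : ℕ) : IsOpen (genericSet κ m n) := by
  have h : ∀ p : MvPolynomial (Fin 2) 𝕜, IsOpen {q : 𝕜 × 𝕜 | ev κ p q ≠ 0} := fun p =>
    isOpen_ne_fun (contDiff_ev κ p).continuous continuous_const
  exact (isOpen_ne_fun continuous_snd continuous_const).inter
    ((h _).inter ((h _).inter (h _)))

/-- Inside an open set, t is first moved off 0, and then x off a finite set. -/
theorem dense_of_finite_slices {s : Set (𝕜 × 𝕜)}
    (h : ∀ t : 𝕜, t ≠ 0 → {x | (x, t) ∉ s}.Finite) : Dense s := by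
  rw [dense_iff_inter_open]
  rintro U hU ⟨⟨x, t⟩, hxt⟩
  obtain ⟨t', ht', ht0⟩ := (dense_compl_singleton (0 : 𝕜)).inter_open_nonempty
    {s | (x, s) ∈ U} (hU.preimage (Continuous.prodMk_right x)) ⟨t, hxt⟩
  obtain ⟨x', hx', hs⟩ := (dense_univ.sdiff_finite (h t' ht0)).inter_open_nonempty
    {y | (y, t') ∈ U} (hU.preimage (Continuous.prodMk_left t')) ⟨x, ht'⟩
  exact ⟨(x', t'), hx', not_not.mp hs.2⟩

theorem dense_genericSet (m n : ℕ) : Dense (genericSet κ m n) := by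
  refine dense_of_finite_slices fun t ht => ?_
  have h := fun m n => finite_setOf_Phi_eq_zero κ t m n
  simp only [Phi_eq_ev] at h
  refine ((h m n).union ((h (m + 1) n).union (h m (n + 1)))).subset fun x hx => ?_
  by_contra hc
  simp only [Set.mem_union, Set.mem_ofPred_eq, not_or] at hc
  exact hx ⟨ht, hc⟩

/-- The first function in the symmetric form of the fourth Painlevé equation. -/
noncomputable def sym₁ (m n : ℕ) (x t : 𝕜) : 𝕜 :=
  logd κ (tau 𝕜 m n) x t - logd κ (tau 𝕜 (m + 1) n) x t

/-- The second function in the symmetric form of the fourth Painlevé equation. -/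
noncomputable def sym₂ (m n : ℕ) (x t : 𝕜) : 𝕜 :=
  logd κ (tau 𝕜 m (n + 1)) x t - logd κ (tau 𝕜 m n) x t

/-- The third function in the symmetric form of the fourth Painlevé equation. -/
noncomputable def sym₃ (m n : ℕ) (x t : 𝕜) : 𝕜 :=
  (x + 2 * κ * t) / (2 * t) - logd κ (tau 𝕜 m (n + 1)) x t + logd κ (tau 𝕜 (m + 1) n) x t

variable {κ} {m n : ℕ}

theorem two_mul_sum_sym (ht : t ≠ 0) :
    2 * t * (sym₁ κ m n x t + sym₂ κ m n x t + sym₃ κ m n x t) = x + 2 * κ * t := by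
  simp only [sym₁, sym₂, sym₃]
  field_simp
  ring

theorem symmetric_logd (h : (x, t) ∈ genericSet κ m n) :
    logd' κ (tau 𝕜 m n) x t - logd' κ (tau 𝕜 (m + 1) n) x t
      = sym₁ κ m n x t * (sym₂ κ m n x t - sym₃ κ m n x t) + -n / (2 * t) ∧
    logd' κ (tau 𝕜 m (n + 1)) x t - logd' κ (tau 𝕜 m n) x t
      = sym₂ κ m n x t * (sym₃ κ m n x t - sym₁ κ m n x t) + -m / (2 * t) ∧
    1 / (2 * t) - logd' κ (tau 𝕜 m (n + 1)) x t + logd' κ (tau 𝕜 (m + 1) n) x t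
      = sym₃ κ m n x t * (sym₁ κ m n x t - sym₂ κ m n x t) + (m + n + 1) / (2 * t) :=
  symmetric_of_bilinear h.1
    (((tauLevel_tau n).left m).logd (κ := κ) (by simp [ev]) h.2.2.1 h.2.1)
    (((tauLevel_tau n).right m).logd (κ := κ) (ev_natCast κ (x, t) m) h.2.1 h.2.2.2)
    (((tauLevel_tau n).middle m).logd (κ := κ) (by simp [ev]) h.2.2.1 h.2.2.2)

theorem hasDerivAt_sym₁_fst (h : (x, t) ∈ genericSet κ m n) :
    HasDerivAt (fun y => sym₁ κ m n y t)
      (sym₁ κ m n x t * (sym₂ κ m n x t - sym₃ κ m n x t) + -n / (2 * t)) x :=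
  ((hasDerivAt_logd_fst h.2.1).fun_sub (hasDerivAt_logd_fst h.2.2.1)).congr_deriv
    (symmetric_logd h).1

theorem hasDerivAt_sym₂_fst (h : (x, t) ∈ genericSet κ m n) :
    HasDerivAt (fun y => sym₂ κ m n y t)
      (sym₂ κ m n x t * (sym₃ κ m n x t - sym₁ κ m n x t) + -m / (2 * t)) x :=
  ((hasDerivAt_logd_fst h.2.2.2).fun_sub (hasDerivAt_logd_fst h.2.1)).congr_deriv
    (symmetric_logd h).2.1

theorem hasDerivAt_sym₃_fst (h : (x, t) ∈ genericSet κ m n) :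
    HasDerivAt (fun y => sym₃ κ m n y t)
      (sym₃ κ m n x t * (sym₁ κ m n x t - sym₂ κ m n x t) + (m + n + 1) / (2 * t)) x :=
  (((((hasDerivAt_id' x).add_const (2 * κ * t)).div_const (2 * t)).fun_sub
    (hasDerivAt_logd_fst h.2.2.2)).fun_add (hasDerivAt_logd_fst h.2.2.1)).congr_deriv
    (symmetric_logd h).2.2

theorem hasDerivAt_sym₁_snd (h : (x, t) ∈ genericSet κ m n) :
    HasDerivAt (fun s => sym₁ κ m n x s)
      (2 * κ * (sym₁ κ m n x t * (sym₂ κ m n x t - sym₃ κ m n x t) + -n / (2 * t))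
        - (sym₁ κ m n x t + (x + 2 * κ * t) *
          (sym₁ κ m n x t * (sym₂ κ m n x t - sym₃ κ m n x t) + -n / (2 * t))) / (2 * t)) t := by
  have e := (symmetric_logd h).1
  refine ((hasDerivAt_logd_tau_snd h.1 h.2.1).fun_sub
    (hasDerivAt_logd_tau_snd h.1 h.2.2.1)).congr_deriv ?_
  rw [← e, sym₁]
  ring

theorem hasDerivAt_sym₂_snd (h : (x, t) ∈ genericSet κ m n) :
    HasDerivAt (fun s => sym₂ κ m n x s)
      (2 * κ * (sym₂ κ m n x t * (sym₃ κ m n x t - sym₁ κ m n x t) + -m / (2 * t))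
        - (sym₂ κ m n x t + (x + 2 * κ * t) *
          (sym₂ κ m n x t * (sym₃ κ m n x t - sym₁ κ m n x t) + -m / (2 * t))) / (2 * t)) t := by
  have e := (symmetric_logd h).2.1
  refine ((hasDerivAt_logd_tau_snd h.1 h.2.2.2).fun_sub
    (hasDerivAt_logd_tau_snd h.1 h.2.1)).congr_deriv ?_
  rw [← e, sym₂]
  ring

theorem hasDerivAt_sym₃_snd (h : (x, t) ∈ genericSet κ m n) :
    HasDerivAt (fun s => sym₃ κ m n x s)
      (2 * κ * (sym₃ κ m n x t * (sym₁ κ m n x t - sym₂ κ m n x t) + (m + n + 1) / (2 * t))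
        - (sym₃ κ m n x t + (x + 2 * κ * t) *
          (sym₃ κ m n x t * (sym₁ κ m n x t - sym₂ κ m n x t) + (m + n + 1) / (2 * t)))
          / (2 * t)) t := by
  have e := (symmetric_logd h).2.2
  have ht0 : t ≠ 0 := h.1
  have hzt : HasDerivAt (fun s => (x + 2 * κ * s) / (2 * s))
      (2 * κ / (2 * t) - (x + 2 * κ * t) / (2 * t ^ 2)) t := by
    refine ((((hasDerivAt_id' t).const_mul (2 * κ)).const_add x).fun_div
      ((hasDerivAt_id' t).const_mul 2) (mul_ne_zero two_ne_zero ht0)).congr_deriv ?_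
    field_simp
  refine ((hzt.fun_sub (hasDerivAt_logd_tau_snd h.1 h.2.2.2)).fun_add
    (hasDerivAt_logd_tau_snd h.1 h.2.2.1)).congr_deriv ?_
  rw [← e, sym₃]
  field_simp
  ring

end Triangle

/-! ### Real logarithms and complex branches, treated through their differential -/

section Logarithms

variable {𝕜 : Type*} [RCLike 𝕜]

/-- `L` is a smooth function on `Ω` with the differential of a logarithm of `f`. -/
structure IsLogOn (Ω : Set (𝕜 × 𝕜)) (f L : 𝕜 × 𝕜 → 𝕜) : Prop where
  ne_zero : ∀ q ∈ Ω, f q ≠ 0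
  contDiffOn : ContDiffOn 𝕜 ∞ L Ω
  hasFDerivAt : ∀ q ∈ Ω, HasFDerivAt L ((f q)⁻¹ • fderiv 𝕜 f q) q

theorem isLogOn_real_log {Ω : Set (ℝ × ℝ)} (hΩ : IsOpen Ω) {f : ℝ × ℝ → ℝ}
    (hf : ContDiffOn ℝ ∞ f Ω) (h0 : ∀ q ∈ Ω, f q ≠ 0) : IsLogOn Ω f (fun q => Real.log (f q)) :=
  ⟨h0, hf.log h0, fun q hq => (hasFDerivAt_of_contDiffOn hΩ hf hq).log (h0 q hq)⟩

/-- Continuity keeps Im(L p - L q) in (-π, π) near q, where the principal logarithm inverts the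
exponential. -/
theorem eventuallyEq_log_of_exp {X : Type*} [TopologicalSpace X] {f L : X → ℂ} {q : X}
    (hL : ContinuousAt L q) (h : ∀ᶠ p in 𝓝 q, Complex.exp (L p) = f p) :
    L =ᶠ[𝓝 q] fun p => L q + Complex.log (f p / f q) := by
  have h1 : ∀ᶠ p in 𝓝 q, |(L p - L q).im| < Real.pi := by
    have hc : ContinuousAt (fun p => |(L p - L q).im|) q :=
      (Complex.continuous_im.continuousAt.comp (hL.sub continuousAt_const)).abs
    exact hc.eventually_lt continuousAt_const (by simp [Real.pi_pos])
  filter_upwards [h, h1] with p hp hp1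
  rw [← hp, ← h.self_of_nhds, ← Complex.exp_sub,
    Complex.log_exp (abs_lt.mp hp1).1 (abs_lt.mp hp1).2.le]
  ring

theorem IsLogBranchOn.isLogOn {Ω : Set (ℂ × ℂ)} (hΩ : IsOpen Ω) {f L : ℂ → ℂ → ℂ}
    (h : IsLogBranchOn Ω f L) (hf : ContDiffOn ℂ ∞ (fun q : ℂ × ℂ => f q.1 q.2) Ω) :
    IsLogOn Ω (fun q => f q.1 q.2) (fun q => L q.1 q.2) := by
  have h0 : ∀ q ∈ Ω, f q.1 q.2 ≠ 0 := fun q hq => by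
    rw [← h.2 q.1 q.2 hq]
    exact Complex.exp_ne_zero _
  have hmem : ∀ q ∈ Ω, f q.1 q.2 / f q.1 q.2 ∈ Complex.slitPlane := fun q hq => by
    rw [div_self (h0 q hq)]
    exact Complex.one_mem_slitPlane
  have hloc : ∀ q ∈ Ω, (fun p : ℂ × ℂ => L p.1 p.2) =ᶠ[𝓝 q]
      fun p => L q.1 q.2 + Complex.log (f p.1 p.2 / f q.1 q.2) := fun q hq =>
    eventuallyEq_log_of_exp (f := fun p : ℂ × ℂ => f p.1 p.2)
      (h.1.continuousAt (hΩ.mem_nhds hq))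
      (Filter.eventually_of_mem (hΩ.mem_nhds hq) fun p hp => h.2 p.1 p.2 hp)
  refine ⟨h0, fun q hq => ?_, fun q hq => ?_⟩
  · have h1 : ContDiffAt ℂ ∞ (fun p : ℂ × ℂ => f p.1 p.2 / f q.1 q.2) q :=
      (hf.contDiffAt (hΩ.mem_nhds hq)).div_const _
    have h2 : ContDiffAt ℂ ∞ (fun p : ℂ × ℂ => Complex.log (f p.1 p.2 / f q.1 q.2)) q :=
      ContDiffAt.comp (g := Complex.log) q (Complex.contDiffAt_log (hmem q hq)) h1
    exact ((contDiffAt_const.add h2).congr_of_eventuallyEq (hloc q hq)).contDiffWithinAt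
  · have h1 : HasFDerivAt (fun p : ℂ × ℂ => f p.1 p.2 / f q.1 q.2)
        ((f q.1 q.2)⁻¹ • fderiv ℂ (fun p : ℂ × ℂ => f p.1 p.2) q) q := by
      simpa only [div_eq_inv_mul] using
        (hasFDerivAt_of_contDiffOn hΩ hf hq).const_mul (f q.1 q.2)⁻¹
    have h2 := (h1.clog (hmem q hq)).const_add (L q.1 q.2)
    rw [div_self (h0 q hq), inv_one, one_smul] at h2
    exact h2.congr_of_eventuallyEq (hloc q hq)

variable {Ω : Set (𝕜 × 𝕜)} {f L : 𝕜 × 𝕜 → 𝕜} {x t f' : 𝕜}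

theorem IsLogOn.hasDerivAt_fst (h : IsLogOn Ω f L) (hxt : (x, t) ∈ Ω)
    (hf : DifferentiableAt 𝕜 f (x, t)) (hf' : HasDerivAt (fun y => f (y, t)) f' x) :
    HasDerivAt (fun y => L (y, t)) (f' / f (x, t)) x := by
  have e := (hasDerivAt_fst_of_hasFDerivAt hf.hasFDerivAt).unique hf'
  refine (hasDerivAt_fst_of_hasFDerivAt (h.hasFDerivAt _ hxt)).congr_deriv ?_
  rw [_root_.smul_apply, e, smul_eq_mul, div_eq_inv_mul]

theorem IsLogOn.hasDerivAt_snd (h : IsLogOn Ω f L) (hxt : (x, t) ∈ Ω)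
    (hf : DifferentiableAt 𝕜 f (x, t)) (hf' : HasDerivAt (fun s => f (x, s)) f' t) :
    HasDerivAt (fun s => L (x, s)) (f' / f (x, t)) t := by
  have e := (hasDerivAt_snd_of_hasFDerivAt hf.hasFDerivAt).unique hf'
  refine (hasDerivAt_snd_of_hasFDerivAt (h.hasFDerivAt _ hxt)).congr_deriv ?_
  rw [_root_.smul_apply, e, smul_eq_mul, div_eq_inv_mul]

open MvPolynomial

variable {κ : 𝕜} {p p' : MvPolynomial (Fin 2) 𝕜}

theorem IsLogOn.ne_zero_left (h : IsLogOn Ω (fun q => ev κ p q / ev κ p' q) L) {q : 𝕜 × 𝕜}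
    (hq : q ∈ Ω) : ev κ p q ≠ 0 := (div_ne_zero_iff.mp (h.ne_zero q hq)).1

theorem IsLogOn.ne_zero_right (h : IsLogOn Ω (fun q => ev κ p q / ev κ p' q) L) {q : 𝕜 × 𝕜}
    (hq : q ∈ Ω) : ev κ p' q ≠ 0 := (div_ne_zero_iff.mp (h.ne_zero q hq)).2

theorem contDiffOn_ev_div (h : ∀ q ∈ Ω, ev κ p' q ≠ 0) :
    ContDiffOn 𝕜 ∞ (fun q => ev κ p q / ev κ p' q) Ω :=
  (contDiff_ev κ p).contDiffOn.div (contDiff_ev κ p').contDiffOn h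

theorem differentiableAt_ev_div {q : 𝕜 × 𝕜} (h : ev κ p' q ≠ 0) :
    DifferentiableAt 𝕜 (fun q => ev κ p q / ev κ p' q) q :=
  ((contDiff_ev κ p).contDiffAt.div (contDiff_ev κ p').contDiffAt h).differentiableAt (by simp)

theorem IsLogOn.hasDerivAt_logd_fst (h : IsLogOn Ω (fun q => ev κ p q / ev κ p' q) L)
    (hxt : (x, t) ∈ Ω) :
    HasDerivAt (fun y => L (y, t)) (logd κ p x t - logd κ p' x t) x := by
  have h1 := h.ne_zero_left hxt
  have h2 := h.ne_zero_right hxt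
  refine (h.hasDerivAt_fst hxt (differentiableAt_ev_div h2)
    ((hasDerivAt_ev_fst κ p x t).fun_div (hasDerivAt_ev_fst κ p' x t) h2)).congr_deriv ?_
  simp only [logd]
  field_simp

theorem IsLogOn.hasDerivAt_tau_snd {m n m' n' : ℕ}
    (h : IsLogOn Ω (fun q => ev κ (tau 𝕜 m n) q / ev κ (tau 𝕜 m' n') q) L)
    (hxt : (x, t) ∈ Ω) (ht : t ≠ 0) :
    HasDerivAt (fun s => L (x, s))
      ((m * n - m' * n' - (x + 2 * κ * t) *
        (logd κ (tau 𝕜 m n) x t - logd κ (tau 𝕜 m' n') x t)) / (2 * t)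
        + 2 * κ * (logd κ (tau 𝕜 m n) x t - logd κ (tau 𝕜 m' n') x t)) t := by
  have h1 := h.ne_zero_left hxt
  have h2 := h.ne_zero_right hxt
  have e1 := euler_ev_tau κ x t m n
  have e2 := euler_ev_tau κ x t m' n'
  refine (h.hasDerivAt_snd hxt (differentiableAt_ev_div h2)
    ((hasDerivAt_ev_snd κ (tau 𝕜 m n) x t).fun_div
      (hasDerivAt_ev_snd κ (tau 𝕜 m' n') x t) h2)).congr_deriv ?_
  simp only [logd]
  generalize ev κ (tau 𝕜 m n) (x, t) = A at *
  generalize ev κ (tau 𝕜 m' n') (x, t) = B at *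
  generalize ev κ (pderiv 0 (tau 𝕜 m n)) (x, t) = A₁ at *
  generalize ev κ (pderiv 0 (tau 𝕜 m' n')) (x, t) = B₁ at *
  field_simp
  linear_combination B * e1 - A * e2

end Logarithms

/-! ### The three families of solutions -/

section Solutions

variable {𝕜 : Type*} [RCLike 𝕜] {Ω : Set (𝕜 × 𝕜)} {κ : 𝕜} {m n : ℕ} {L T : 𝕜 × 𝕜 → 𝕜}

theorem IsLogOn.hasDerivAt_time (hT : IsLogOn Ω (fun q => q.2) T) {x t : 𝕜} (h : (x, t) ∈ Ω) :
    HasDerivAt (fun y => T (y, t)) 0 x ∧ HasDerivAt (fun s => T (x, s)) (1 / t) t :=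
  ⟨(hT.hasDerivAt_fst h differentiableAt_snd (hasDerivAt_const x t)).congr_deriv (zero_div _),
    hT.hasDerivAt_snd h differentiableAt_snd (hasDerivAt_id' t)⟩

theorem hasDerivAt_gaussian_fst (x t : 𝕜) :
    HasDerivAt (fun y => y ^ 2 / (4 * t)) (x / (2 * t)) x := by
  refine (((hasDerivAt_id' x).fun_pow 2).div_const (4 * t)).congr_deriv ?_
  rcases eq_or_ne t 0 with rfl | ht
  · simp
  · field_simp
    ring

theorem hasDerivAt_gaussian_snd (x : 𝕜) {t : 𝕜} (ht : t ≠ 0) :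
    HasDerivAt (fun s => x ^ 2 / (4 * s)) (-x ^ 2 / (4 * t ^ 2)) t := by
  have h4 : (4 * t : 𝕜) ≠ 0 := mul_ne_zero (by norm_num) ht
  refine ((hasDerivAt_const t (x ^ 2)).fun_div ((hasDerivAt_id' t).const_mul 4) h4).congr_deriv ?_
  field_simp
  ring

theorem contDiffOn_gaussian (h : ∀ q ∈ Ω, q.2 ≠ 0) :
    ContDiffOn 𝕜 ∞ (fun q : 𝕜 × 𝕜 => q.1 ^ 2 / (4 * q.2)) Ω :=
  (contDiff_fst.pow 2).contDiffOn.div (contDiff_const.mul contDiff_snd).contDiffOn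
    fun q hq => mul_ne_zero (by norm_num) (h q hq)

/-- The coefficient of ln t is forced by weights: n - 2(m + n + 1/2) = a₂ - a₃, where n is the
weight difference of the two tau functions. -/
theorem isDWWSolutionOn_first (hΩ : IsOpen Ω)
    (hL : IsLogOn Ω (fun q => ev κ (tau 𝕜 (m + 1) n) q / ev κ (tau 𝕜 m n) q) L)
    (hT : IsLogOn Ω (fun q => q.2) T) :
    IsDWWSolutionOn Ω (fun x t => L (x, t) + x ^ 2 / (4 * t)
      - ((m : 𝕜) + (n : 𝕜) + 1 / 2) * T (x, t)) := by
  refine isDWWSolutionOn_of_dense hΩ ((hL.contDiffOn.add (contDiffOn_gaussian hT.ne_zero)).sub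
    (contDiffOn_const.mul hT.contDiffOn)) (dense_genericSet κ m n) fun x t hxt => ?_
  refine dwwExpr_eq_zero_of_symmetric (hΩ.inter (isOpen_genericSet κ m n)) (κ := κ)
    (a₁ := -n) (a₂ := -m) (a₃ := m + n + 1) (by ring) (fun x t h => h.2.1)
    (fun x t h => two_mul_sum_sym h.2.1) (fun x t h => hasDerivAt_sym₁_fst h.2)
    (fun x t h => hasDerivAt_sym₂_fst h.2) (fun x t h => hasDerivAt_sym₃_fst h.2)
    (fun x t h => hasDerivAt_sym₁_snd h.2) (fun x t h => ?_) (fun x t h => ?_) hxt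
  · refine (((hL.hasDerivAt_logd_fst h.1).fun_add (hasDerivAt_gaussian_fst x t)).fun_sub
      ((hT.hasDerivAt_time h.1).1.const_mul _)).congr_deriv ?_
    have ht : t ≠ 0 := h.2.1
    rw [sym₁]
    field_simp
    ring
  · have ht : t ≠ 0 := h.2.1
    refine (((hL.hasDerivAt_tau_snd h.1 ht).fun_add (hasDerivAt_gaussian_snd x ht)).fun_sub
      ((hT.hasDerivAt_time h.1).2.const_mul _)).congr_deriv ?_
    rw [sym₁]
    push_cast
    field_simp
    ring

theorem isDWWSolutionOn_second (hΩ : IsOpen Ω)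
    (hL : IsLogOn Ω (fun q => ev κ (tau 𝕜 m n) q / ev κ (tau 𝕜 m (n + 1)) q) L)
    (hT : IsLogOn Ω (fun q => q.2) T) :
    IsDWWSolutionOn Ω (fun x t => L (x, t) + x ^ 2 / (4 * t)
      + ((m : 𝕜) + (n : 𝕜) + 1 / 2) * T (x, t)) := by
  refine isDWWSolutionOn_of_dense hΩ ((hL.contDiffOn.add (contDiffOn_gaussian hT.ne_zero)).add
    (contDiffOn_const.mul hT.contDiffOn)) (dense_genericSet κ m n) fun x t hxt => ?_
  -- The Painlevé triple is shifted cyclically, with `sym₂` in the role of g₁.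
  refine dwwExpr_eq_zero_of_symmetric (hΩ.inter (isOpen_genericSet κ m n)) (κ := κ)
    (a₁ := -m) (a₂ := m + n + 1) (a₃ := -n) (by ring) (fun x t h => h.2.1)
    (fun x t h => by rw [← two_mul_sum_sym (m := m) (n := n) h.2.1]; ring)
    (fun x t h => hasDerivAt_sym₂_fst h.2) (fun x t h => hasDerivAt_sym₃_fst h.2)
    (fun x t h => hasDerivAt_sym₁_fst h.2)
    (fun x t h => hasDerivAt_sym₂_snd h.2) (fun x t h => ?_) (fun x t h => ?_) hxt
  · refine (((hL.hasDerivAt_logd_fst h.1).fun_add (hasDerivAt_gaussian_fst x t)).fun_add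
      ((hT.hasDerivAt_time h.1).1.const_mul _)).congr_deriv ?_
    have ht : t ≠ 0 := h.2.1
    rw [sym₂]
    field_simp
    ring
  · have ht : t ≠ 0 := h.2.1
    refine (((hL.hasDerivAt_tau_snd h.1 ht).fun_add (hasDerivAt_gaussian_snd x ht)).fun_add
      ((hT.hasDerivAt_time h.1).2.const_mul _)).congr_deriv ?_
    rw [sym₂]
    push_cast
    field_simp
    ring

/-- No ln t is needed, because the weight difference m - n already equals a₂ - a₃. Points of Ω with
t = 0 are reached by density. -/
theorem isDWWSolutionOn_third (hΩ : IsOpen Ω)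
    (hL : IsLogOn Ω (fun q => ev κ (tau 𝕜 m (n + 1)) q / ev κ (tau 𝕜 (m + 1) n) q) L) :
    IsDWWSolutionOn Ω (fun x t => L (x, t) - κ * (x + κ * t)) := by
  refine isDWWSolutionOn_of_dense hΩ (hL.contDiffOn.sub (contDiff_const.mul
    (contDiff_fst.add (contDiff_const.mul contDiff_snd))).contDiffOn)
    (dense_genericSet κ m n) fun x t hxt => ?_
  refine dwwExpr_eq_zero_of_symmetric (hΩ.inter (isOpen_genericSet κ m n)) (κ := κ)
    (a₁ := m + n + 1) (a₂ := -n) (a₃ := -m) (by ring) (fun x t h => h.2.1)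
    (fun x t h => by rw [← two_mul_sum_sym (m := m) (n := n) h.2.1]; ring)
    (fun x t h => hasDerivAt_sym₃_fst h.2) (fun x t h => hasDerivAt_sym₁_fst h.2)
    (fun x t h => hasDerivAt_sym₂_fst h.2)
    (fun x t h => hasDerivAt_sym₃_snd h.2) (fun x t h => ?_) (fun x t h => ?_) hxt
  · refine ((hL.hasDerivAt_logd_fst h.1).fun_sub
      (((hasDerivAt_id' x).add_const (κ * t)).const_mul κ)).congr_deriv ?_
    rw [sym₃]
    ring
  · have ht : t ≠ 0 := h.2.1
    refine ((hL.hasDerivAt_tau_snd h.1 ht).fun_sub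
      ((((hasDerivAt_id' t).const_mul κ).const_add x).const_mul κ)).congr_deriv ?_
    rw [sym₃]
    push_cast
    field_simp
    ring

theorem IsLogBranchOn.isLogOn_ev_div {Ω : Set (ℂ × ℂ)} (hΩ : IsOpen Ω) {κ : ℂ}
    {p p' : MvPolynomial (Fin 2) ℂ} {L : ℂ → ℂ → ℂ}
    (h : IsLogBranchOn Ω (fun x t => ev κ p (x, t) / ev κ p' (x, t)) L) :
    IsLogOn Ω (fun q => ev κ p q / ev κ p' q) (fun q => L q.1 q.2) := by
  refine h.isLogOn hΩ (contDiffOn_ev_div fun q hq => ?_)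
  -- As r / 0 = 0 is never a value of exp, a branch of the logarithm of the quotient forces the
  -- denominator to be nonzero.
  have h0 := Complex.exp_ne_zero (L q.1 q.2)
  rw [h.2 q.1 q.2 hq] at h0
  exact (div_ne_zero_iff.mp h0).2

end Solutions

end DWW

/- Part I: real `x, t, κ` (here `Real.log r = ln |r|` for `r ≠ 0`).
Part II: complex `x, t, κ`, with arbitrary continuous branches of the logarithms. -/
theorem mainTheorem1 (m n : ℕ) :
    (∀ κ : ℝ,
      (∀ x t l : ℝ, HasSum (fun k : ℕ => DWW.phi k x t κ * l ^ k / (k.factorial : ℝ))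
        (Real.exp ((x + 2 * κ * t) * l - t * l ^ 2))) ∧
      (∀ (k : ℕ) (x t : ℝ), 0 < t →
        DWW.phi k x t κ
          = t ^ ((k : ℝ) / 2) * DWW.hermiteH k ((x + 2 * κ * t) / Real.sqrt (4 * t))) ∧
      (∀ t : ℝ, {x : ℝ | DWW.Phi m n x t κ = 0}.Finite) ∧
      DWW.IsDWWSolutionOn
        {p : ℝ × ℝ | p.2 ≠ 0 ∧ DWW.Phi (m + 1) n p.1 p.2 κ ≠ 0 ∧ DWW.Phi m n p.1 p.2 κ ≠ 0}
        (fun x t => Real.log (DWW.Phi (m + 1) n x t κ / DWW.Phi m n x t κ)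
          + x ^ 2 / (4 * t) - ((m : ℝ) + (n : ℝ) + 1 / 2) * Real.log t) ∧
      DWW.IsDWWSolutionOn
        {p : ℝ × ℝ | p.2 ≠ 0 ∧ DWW.Phi m n p.1 p.2 κ ≠ 0 ∧ DWW.Phi m (n + 1) p.1 p.2 κ ≠ 0}
        (fun x t => Real.log (DWW.Phi m n x t κ / DWW.Phi m (n + 1) x t κ)
          + x ^ 2 / (4 * t) + ((m : ℝ) + (n : ℝ) + 1 / 2) * Real.log t) ∧
      DWW.IsDWWSolutionOn
        {p : ℝ × ℝ | DWW.Phi m (n + 1) p.1 p.2 κ ≠ 0 ∧ DWW.Phi (m + 1) n p.1 p.2 κ ≠ 0}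
        (fun x t => Real.log (DWW.Phi m (n + 1) x t κ / DWW.Phi (m + 1) n x t κ)
          - κ * (x + κ * t))) ∧
    (∀ κ : ℂ,
      (∀ x t l : ℂ, HasSum (fun k : ℕ => DWW.phi k x t κ * l ^ k / (k.factorial : ℂ))
        (Complex.exp ((x + 2 * κ * t) * l - t * l ^ 2))) ∧
      (∀ (k : ℕ) (x t s : ℂ), s ^ 2 = t → t ≠ 0 →
        DWW.phi k x t κ = s ^ k * DWW.hermiteH k ((x + 2 * κ * t) / (2 * s))) ∧
      (∀ t : ℂ, {x : ℂ | DWW.Phi m n x t κ = 0}.Finite) ∧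
      (∀ (Ω : Set (ℂ × ℂ)) (L T : ℂ → ℂ → ℂ), IsOpen Ω →
        DWW.IsLogBranchOn Ω (fun x t => DWW.Phi (m + 1) n x t κ / DWW.Phi m n x t κ) L →
        DWW.IsLogBranchOn Ω (fun _ t => t) T →
        DWW.IsDWWSolutionOn Ω (fun x t => L x t
          + x ^ 2 / (4 * t) - ((m : ℂ) + (n : ℂ) + 1 / 2) * T x t)) ∧
      (∀ (Ω : Set (ℂ × ℂ)) (L T : ℂ → ℂ → ℂ), IsOpen Ω →
        DWW.IsLogBranchOn Ω (fun x t => DWW.Phi m n x t κ / DWW.Phi m (n + 1) x t κ) L →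
        DWW.IsLogBranchOn Ω (fun _ t => t) T →
        DWW.IsDWWSolutionOn Ω (fun x t => L x t
          + x ^ 2 / (4 * t) + ((m : ℂ) + (n : ℂ) + 1 / 2) * T x t)) ∧
      (∀ (Ω : Set (ℂ × ℂ)) (L : ℂ → ℂ → ℂ), IsOpen Ω →
        DWW.IsLogBranchOn Ω (fun x t => DWW.Phi m (n + 1) x t κ / DWW.Phi (m + 1) n x t κ) L →
        DWW.IsDWWSolutionOn Ω (fun x t => L x t - κ * (x + κ * t)))) := by
  have hopen : ∀ {κ : ℝ} (p : MvPolynomial (Fin 2) ℝ), IsOpen {q : ℝ × ℝ | DWW.ev κ p q ≠ 0} :=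
    fun p => isOpen_ne_fun (DWW.contDiff_ev _ p).continuous continuous_const
  have htime : IsOpen {q : ℝ × ℝ | q.2 ≠ 0} := isOpen_ne_fun continuous_snd continuous_const
  refine ⟨fun κ => ⟨DWW.hasSum_phi_real κ, fun k x t ht => DWW.phi_eq_rpow_mul_hermiteH κ x t ht k,
    fun t => DWW.finite_setOf_Phi_eq_zero κ t m n, ?_, ?_, ?_⟩,
    fun κ => ⟨DWW.hasSum_phi_complex κ,
      fun k x t s hs ht => DWW.phi_eq_hermiteH κ x t s hs ht k,
      fun t => DWW.finite_setOf_Phi_eq_zero κ t m n,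
      fun Ω L T hΩ hL hT => ?_, fun Ω L T hΩ hL hT => ?_, fun Ω L hΩ hL => ?_⟩⟩
  · simp only [DWW.Phi_eq_ev]
    have hΩ : IsOpen {q : ℝ × ℝ | q.2 ≠ 0 ∧ DWW.ev κ (DWW.tau ℝ (m + 1) n) q ≠ 0 ∧
        DWW.ev κ (DWW.tau ℝ m n) q ≠ 0} := htime.inter ((hopen _).inter (hopen _))
    exact DWW.isDWWSolutionOn_first hΩ
      (DWW.isLogOn_real_log hΩ (DWW.contDiffOn_ev_div fun q hq => hq.2.2)
        fun q hq => div_ne_zero hq.2.1 hq.2.2)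
      (DWW.isLogOn_real_log hΩ contDiff_snd.contDiffOn fun q hq => hq.1)
  · simp only [DWW.Phi_eq_ev]
    have hΩ : IsOpen {q : ℝ × ℝ | q.2 ≠ 0 ∧ DWW.ev κ (DWW.tau ℝ m n) q ≠ 0 ∧
        DWW.ev κ (DWW.tau ℝ m (n + 1)) q ≠ 0} := htime.inter ((hopen _).inter (hopen _))
    exact DWW.isDWWSolutionOn_second hΩ
      (DWW.isLogOn_real_log hΩ (DWW.contDiffOn_ev_div fun q hq => hq.2.2)
        fun q hq => div_ne_zero hq.2.1 hq.2.2)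
      (DWW.isLogOn_real_log hΩ contDiff_snd.contDiffOn fun q hq => hq.1)
  · simp only [DWW.Phi_eq_ev]
    have hΩ : IsOpen {q : ℝ × ℝ | DWW.ev κ (DWW.tau ℝ m (n + 1)) q ≠ 0 ∧
        DWW.ev κ (DWW.tau ℝ (m + 1) n) q ≠ 0} := (hopen _).inter (hopen _)
    exact DWW.isDWWSolutionOn_third hΩ
      (DWW.isLogOn_real_log hΩ (DWW.contDiffOn_ev_div fun q hq => hq.2)
        fun q hq => div_ne_zero hq.1 hq.2)
  · simp only [DWW.Phi_eq_ev] at hL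
    exact DWW.isDWWSolutionOn_first hΩ (hL.isLogOn_ev_div hΩ)
      (hT.isLogOn hΩ contDiff_snd.contDiffOn)
  · simp only [DWW.Phi_eq_ev] at hL
    exact DWW.isDWWSolutionOn_second hΩ (hL.isLogOn_ev_div hΩ)
      (hT.isLogOn hΩ contDiff_snd.contDiffOn)
  · simp only [DWW.Phi_eq_ev] at hL
    exact DWW.isDWWSolutionOn_third hΩ (hL.isLogOn_ev_div hΩ)
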